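/- A \emph{$3$-network of class $H^2$} is a triple $\Gamma=\{\gamma^1,\gamma^2,\gamma^3\}$ of curves $\gamma^i\in H^2((0,1);\mathbb{R}^2)$ with $\gamma^1(0)=\gamma^2(0)=\gamma^3(0)=:P^1$ and $\gamma^1(1)=\gamma^2(1)=\gamma^3(1)=:P^2$. A curve is regular if $\gamma_x\neq 0$ on $[0,1]$; every regular curve of a network is parametrized with constant speed equal to its length $L(\gamma^i)$, and $\tau^i=\gamma^i_x/|\gamma^i_x|$ denotes its unit tangent. Non-regular curves, curves of length zero, and $P^1=P^2$ are allowed. $\Gamma$ is a \emph{Theta-network} if its three curves are regular and at each of the two junctions any two of them form an angle of $120$ degrees, i.e. $\angle(\tau^i(x),\tau^j(x))=2\pi/3$ for $i\neq j$ and $x\in\{0,1\}$. $\Gamma$ is a \emph{``degenerate'' Theta-network} if one of its curves has length zero (so that $P^1=P^2$) and the other two, $\gamma^i$ and $\gamma^j$, are regular and form at this point angles in pairs of $120$ and $60$ degrees, i.e. $\{\tau^i(0),-\tau^i(1),\tau^j(0),-\tau^j(1)\}=\{v,-v,w,-w\}$ for two unit vectors $v,w$ with $\angle(v,w)=2\pi/3$.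 Let $$\overline F(\Gamma)=\sum_{i}\Big(\frac{1}{L(\gamma^i)^3}\int_0^1|\gamma^i_{xx}|^2\,dx+L(\gamma^i)\Big),$$ where the sum is over the three curves if $\Gamma$ is a Theta-network and over the two curves of positive length if $\Gamma$ is a ``degenerate'' Theta-network, and let $\overline F(\Gamma)=+\infty$ for every other $3$-network of class $H^2$. \textbf{Proposition.} Let $\Gamma_n=\{\gamma_n^1,\gamma_n^2,\gamma_n^3\}$ be a sequence of $3$-networks of class $H^2$, each having one of its two triple junctions at the origin, such that $\limsup_{n}\overline F(\Gamma_n)<+\infty$. Then there are a subsequence $(\Gamma_{n_k})_k$ and a $3$-network $\Gamma=\{\gamma^1,\gamma^2,\gamma^3\}$ of class $H^2$ such that, for $i=1,2,3$, $\gamma^i_{n_k}\rightharpoonup\gamma^i$ weakly in $H^2((0,1);\mathbb{R}^2)$ and $\gamma^i_{n_k}\to\gamma^i$ strongly in $C^{1,\alpha}([0,1];\mathbb{R}^2)$ for every $\alpha\in(0,\tfrac12)$. The network $\Gamma$ is either a Theta-network or a ``degenerate'' Theta-network; in particular, at most one of its three curves has length zero. -/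

import Mathlib

open Set Filter Topology MeasureTheory
open scoped ContDiff ENNReal

noncomputable section

/-- The Euclidean plane. -/
abbrev Plane : Type := EuclideanSpace ℝ (Fin 2)

/-- `g` is the weak derivative of `f` on the open interval `(0,1)`. -/
def HasWeakDeriv (f g : ℝ → Plane) : Prop :=
  ∀ φ : ℝ → ℝ, ContDiff ℝ ∞ φ → tsupport φ ⊆ Ioo 0 1 →
    ∫ x in (0 : ℝ)..1, deriv φ x • f x = -∫ x in (0 : ℝ)..1, φ x • g x

/-- An element of `H²((0,1); ℝ²)`, i.e. a parametrized plane curve `[0,1] → ℝ²` of class `H²`: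
`pos` and `vel` are the continuous representatives on `[0,1]` of the curve and of its weak
derivative, `acc` is its second weak derivative, which is square integrable. Values outside
`[0,1]` play no role. -/
structure H2Curve where
  pos : ℝ → Plane
  vel : ℝ → Plane
  acc : ℝ → Plane
  continuousOn_pos : ContinuousOn pos (Icc 0 1)
  continuousOn_vel : ContinuousOn vel (Icc 0 1)
  memLp_acc : MemLp acc 2 (volume.restrict (Ioo 0 1))
  weak_vel : HasWeakDeriv pos vel
  weak_acc : HasWeakDeriv vel acc

namespace H2Curve

/-- The curve is regular: its velocity vanishes nowhere on `[0,1]`. -/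
def IsRegular (c : H2Curve) : Prop := ∀ x ∈ Icc (0 : ℝ) 1, c.vel x ≠ 0

/-- The unit tangent vector (used for regular curves). -/
def tangent (c : H2Curve) (x : ℝ) : Plane := ‖c.vel x‖⁻¹ • c.vel x

/-- The length of the curve. -/
def length (c : H2Curve) : ℝ := ∫ x in (0 : ℝ)..1, ‖c.vel x‖

/-- The penalized elastic energy (elastic energy plus length) of a regular curve that is
parametrized on `[0,1]` with constant speed equal to its length. -/
def energy (c : H2Curve) : ℝ :=
  1 / c.length ^ 3 * (∫ x in (0 : ℝ)..1, ‖c.acc x‖ ^ 2) + c.length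

/-- The inner product of the Hilbert space `H²((0,1); ℝ²)`. -/
def innerH2 (c d : H2Curve) : ℝ :=
  (∫ x in (0 : ℝ)..1, inner ℝ (c.pos x) (d.pos x)) +
    (∫ x in (0 : ℝ)..1, inner ℝ (c.vel x) (d.vel x)) +
    ∫ x in (0 : ℝ)..1, inner ℝ (c.acc x) (d.acc x)

/-- Weak convergence of a sequence in the Hilbert space `H²((0,1); ℝ²)`. -/
def WeakTendsto (c : ℕ → H2Curve) (c' : H2Curve) : Prop :=
  ∀ d : H2Curve, Tendsto (fun n => innerH2 (c n) d) atTop (𝓝 (innerH2 c' d))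

/-- The `C^{1,α}([0,1])` norm of the difference of two curves. -/
def holderDist (α : ℝ) (c d : H2Curve) : ℝ≥0∞ :=
  (⨆ x ∈ Icc (0 : ℝ) 1, ‖c.pos x - d.pos x‖ₑ) +
    (⨆ x ∈ Icc (0 : ℝ) 1, ‖c.vel x - d.vel x‖ₑ) +
    ⨆ x ∈ Icc (0 : ℝ) 1, ⨆ y ∈ Icc (0 : ℝ) 1, ⨆ _ : x ≠ y,
      ‖(c.vel x - d.vel x) - (c.vel y - d.vel y)‖ₑ / ENNReal.ofReal (|x - y| ^ α)

end H2Curve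

/-- A `3`-network of class `H²`: three `H²` curves on `[0,1]` that start at one common junction
`P₁` and end at another common junction `P₂`. As usual, its regular curves are parametrized with
constant speed equal to their length. Curves need not be regular and may have length zero, and
`P₁ = P₂` is allowed. -/
structure ThreeNetwork where
  curve : Fin 3 → H2Curve
  P₁ : Plane
  P₂ : Plane
  start_eq : ∀ i, (curve i).pos 0 = P₁
  end_eq : ∀ i, (curve i).pos 1 = P₂
  constSpeed : ∀ i, (curve i).IsRegular →
    ∀ x ∈ Icc (0 : ℝ) 1, ‖(curve i).vel x‖ = (curve i).length

namespace ThreeNetwork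

/-- A Theta-network: the three curves are regular and, at each of the two junctions, any two of
them form an angle of `120` degrees. -/
def IsTheta (Γ : ThreeNetwork) : Prop :=
  (∀ i, (Γ.curve i).IsRegular) ∧
    ∀ i j, i ≠ j →
      InnerProductGeometry.angle ((Γ.curve i).tangent 0) ((Γ.curve j).tangent 0)
          = 2 * Real.pi / 3 ∧
        InnerProductGeometry.angle ((Γ.curve i).tangent 1) ((Γ.curve j).tangent 1)
          = 2 * Real.pi / 3

/-- A "degenerate" Theta-network: one curve has length zero (so that `P₁ = P₂` and the two others
are closed), the two others are regular and form angles in pairs of `120` and `60` degrees, that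
is, the four unit vectors which leave the common junction along the two curves are
`v, -v, w, -w` for two unit vectors `v, w` at an angle of `120` degrees. -/
def IsDegenerateTheta (Γ : ThreeNetwork) : Prop :=
  ∃ i j k : Fin 3, i ≠ j ∧ i ≠ k ∧ j ≠ k ∧
    (Γ.curve i).IsRegular ∧ (Γ.curve j).IsRegular ∧ (Γ.curve k).length = 0 ∧
    ∃ v w : Plane, ‖v‖ = 1 ∧ ‖w‖ = 1 ∧
      InnerProductGeometry.angle v w = 2 * Real.pi / 3 ∧
      ({(Γ.curve i).tangent 0, -(Γ.curve i).tangent 1,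
        (Γ.curve j).tangent 0, -(Γ.curve j).tangent 1} : Set Plane) = {v, -v, w, -w}

open Classical in
/-- The extended energy: the total penalized elastic energy on Theta-networks, the energy of the
two curves of positive length on "degenerate" Theta-networks, and `+∞` on all other
`3`-networks of class `H²`. -/
def extendedEnergy (Γ : ThreeNetwork) : EReal :=
  if Γ.IsTheta then ((∑ i, (Γ.curve i).energy : ℝ) : EReal)
  else if Γ.IsDegenerateTheta then
    ((∑ i with (Γ.curve i).length ≠ 0, (Γ.curve i).energy : ℝ) : EReal)
  else ⊤

end ThreeNetwork

end

/-! Finite energy at most `M` gives each curve of positive length the bounds `L ≤ M` and `∫ ‖acc‖² ≤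
M * L ^ 3`; a curve of length zero satisfies them trivially. These two bounds and constant speed are
packaged as `Controlled M`, and everything else rests on them.

Compactness: one junction is at the origin and speeds are at most `M`, so positions are bounded, and
by Cauchy-Schwarz the velocities are uniformly `1/2`-Hölder. Weak compactness in `L²` yields a limit
second derivative. Integrating it twice gives the limit curve, with pointwise and then uniform
convergence of positions and velocities; interpolation with the `1/2`-Hölder bound upgrades this to
`C^{1,α}` for `α < 1/2` (`H2Curve.exists_subseq_convergesTo`).

Identification of the limit: the factor `L ^ 3` makes the unit tangent vary by at most `√(M * L)`
between the endpoints, so a short curve is almost straight. Three consequences follow. Two curves of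
a Theta-network cannot both shrink: they share their chord, so their initial tangents would almost
point the same way, against the 120 degree condition (`IsTheta.lt_sqrt_or_lt_sqrt`). If exactly one
shrinks, its two end tangents merge. The three tangents at a junction sum to zero, so the other two
have the same sum at both junctions. In the plane this determines the pair up to a swap
(`eq_or_eq_swap_of_add_eq`), and either alternative is the degenerate angle condition. If none
shrinks, the angles pass to the limit. For degenerate networks the regular curves are closed; a
vanishing chord forces `1 ≤ M * L`, so they cannot shrink. -/

/-! ### Weak derivatives on the unit interval and the Cauchy-Schwarz bound -/

/-- A smooth function supported in `(0,1)` with integral zero is the derivative of a smooth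
function supported in `(0,1)`. -/
theorem exists_contDiff_deriv_eq_of_integral_eq_zero {χ : ℝ → ℝ} (hχ : ContDiff ℝ ∞ χ)
    (hs : tsupport χ ⊆ Ioo 0 1) (h0 : ∫ x in (0 : ℝ)..1, χ x = 0) :
    ∃ φ : ℝ → ℝ, ContDiff ℝ ∞ φ ∧ tsupport φ ⊆ Ioo 0 1 ∧ deriv φ = χ := by
  have hd : ∀ x, HasDerivAt (fun x => ∫ t in (0 : ℝ)..x, χ t) (χ x) x := fun x =>
    intervalIntegral.integral_hasDerivAt_right (hχ.continuous.intervalIntegrable _ _)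
      (hχ.continuous.stronglyMeasurableAtFilter _ _) hχ.continuous.continuousAt
  have hde : deriv (fun x => ∫ t in (0 : ℝ)..x, χ t) = χ := funext fun x => (hd x).deriv
  refine ⟨_, ?_, ?_, hde⟩
  · rw [contDiff_infty_iff_deriv, hde]
    exact ⟨fun x => (hd x).differentiableAt, hχ⟩
  have hK : IsCompact (tsupport χ) :=
    isCompact_Icc.of_isClosed_subset (isClosed_tsupport _) (hs.trans Ioo_subset_Icc_self)
  obtain ⟨a, b, ha, hb, hab⟩ : ∃ a b : ℝ, 0 < a ∧ b < 1 ∧ tsupport χ ⊆ Icc a b := by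
    rcases (tsupport χ).eq_empty_or_nonempty with h | h
    · exact ⟨1, 0, by norm_num, by norm_num, by simp [h]⟩
    · obtain ⟨a, ha⟩ := hK.exists_isLeast h
      obtain ⟨b, hb⟩ := hK.exists_isGreatest h
      exact ⟨a, b, (hs ha.1).1, (hs hb.1).2, fun x hx => ⟨ha.2 hx, hb.2 hx⟩⟩
  have hz : ∀ x, x ∉ Icc a b → χ x = 0 := fun x hx => image_eq_zero_of_notMem_tsupport
    fun h => hx (hab h)
  refine (closure_minimal (fun x hx => ?_) isClosed_Icc).trans
    (Icc_subset_Ioo ha hb)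
  by_contra hx'
  apply hx
  show ∫ t in (0 : ℝ)..x, χ t = 0
  rcases lt_or_ge x a with h | h
  · rw [intervalIntegral.integral_congr (g := fun _ => (0 : ℝ)), intervalIntegral.integral_zero]
    intro t ht
    refine hz t fun h' => ?_
    have := ht.2
    have : t < a := lt_of_le_of_lt this (max_lt ha h)
    exact absurd h'.1 (not_le.2 this)
  · have hbx : b < x := by
      by_contra hh
      exact hx' ⟨h, not_lt.1 hh⟩
    have : ∫ t in x..1, χ t = 0 := by
      rw [intervalIntegral.integral_congr (g := fun _ => (0 : ℝ)), intervalIntegral.integral_zero]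
      intro t ht
      refine hz t fun h' => ?_
      have := ht.1
      have : b < t := lt_of_lt_of_le (lt_min hbx hb) this
      exact absurd h'.2 (not_le.2 this)
    have h2 := intervalIntegral.integral_add_adjacent_intervals
      (hχ.continuous.intervalIntegrable (μ := volume) 0 x)
      (hχ.continuous.intervalIntegrable (μ := volume) x 1)
    linarith

/-- The lemma of du Bois-Reymond on `(0,1)`. -/
theorem eqOn_const_of_integral_deriv_mul_eq_zero {h : ℝ → ℝ} (hc : ContinuousOn h (Icc 0 1))
    (hw : ∀ φ : ℝ → ℝ, ContDiff ℝ ∞ φ → tsupport φ ⊆ Ioo 0 1 →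
      ∫ x in (0 : ℝ)..1, deriv φ x * h x = 0) :
    ∀ x ∈ Icc (0 : ℝ) 1, h x = h 0 := by
  have hci : ContinuousOn h (uIcc 0 1) := by rwa [uIcc_of_le zero_le_one]
  obtain ⟨η, hη, hηs, hη1⟩ : ∃ η : ℝ → ℝ, ContDiff ℝ ∞ η ∧ tsupport η ⊆ Ioo 0 1 ∧
      ∫ x in (0 : ℝ)..1, η x = 1 := by
    let f : ContDiffBump (1 / 2 : ℝ) := ⟨1 / 8, 1 / 4, by norm_num, by norm_num⟩
    have hfs : tsupport f ⊆ Ioo 0 1 := by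
      rw [f.tsupport_eq, Real.closedBall_eq_Icc]
      exact Icc_subset_Ioo (by norm_num [f]) (by norm_num [f])
    have hfn : tsupport (f.normed volume) ⊆ Ioo 0 1 := by
      rw [f.tsupport_normed_eq, ← f.tsupport_eq]; exact hfs
    refine ⟨f.normed volume, f.contDiff_normed, hfn, ?_⟩
    rw [intervalIntegral.integral_of_le zero_le_one, setIntegral_eq_integral_of_forall_compl_eq_zero,
      f.integral_normed]
    intro x hx
    exact image_eq_zero_of_notMem_tsupport fun h' => hx (Ioo_subset_Ioc_self (hfn h'))
  set c := ∫ x in (0 : ℝ)..1, η x * h x with hcdef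
  -- Subtracting from `ψ` its integral times `η` leaves a function of mean zero, hence an admissible
  -- derivative. So `h` minus its `η`-weighted mean `c` is orthogonal to every test function.
  have key : ∀ ψ : ℝ → ℝ, ContDiff ℝ ∞ ψ → tsupport ψ ⊆ Ioo 0 1 →
      ∫ x in (0 : ℝ)..1, ψ x * (h x - c) = 0 := by
    intro ψ hψ hψs
    set m := ∫ x in (0 : ℝ)..1, ψ x with hm
    have hi : ∀ g : ℝ → ℝ, Continuous g → IntervalIntegrable g volume 0 1 :=
      fun g hg => hg.intervalIntegrable _ _
    have hih : ∀ g : ℝ → ℝ, Continuous g → IntervalIntegrable (fun x => g x * h x) volume 0 1 :=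
      fun g hg => (hg.continuousOn.mul hci).intervalIntegrable
    obtain ⟨φ, h1, h2, h3⟩ := exists_contDiff_deriv_eq_of_integral_eq_zero
      (χ := fun x => ψ x - m * η x) (hψ.sub (contDiff_const.mul hη))
      (by
        refine (tsupport_sub _ _).trans (union_subset hψs ?_)
        exact (closure_mono fun x hx => by
          simp only [Function.mem_support] at hx ⊢
          exact right_ne_zero_of_mul hx).trans hηs)
      (by
        rw [intervalIntegral.integral_sub (hi _ hψ.continuous)
          ((hi _ hη.continuous).const_mul m), intervalIntegral.integral_const_mul, hη1, ← hm]
        ring)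
    have h4 := hw φ h1 h2
    rw [h3] at h4
    have e1 : ∫ x in (0 : ℝ)..1, (ψ x - m * η x) * h x
        = (∫ x in (0 : ℝ)..1, ψ x * h x) - m * c := by
      rw [hcdef, ← intervalIntegral.integral_const_mul, ← intervalIntegral.integral_sub
        (hih _ hψ.continuous) ((hih _ hη.continuous).const_mul m)]
      exact intervalIntegral.integral_congr fun x _ => by ring
    have e2 : ∫ x in (0 : ℝ)..1, ψ x * (h x - c)
        = (∫ x in (0 : ℝ)..1, ψ x * h x) - m * c := by
      rw [hm, ← intervalIntegral.integral_mul_const, ← intervalIntegral.integral_sub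
        (hih _ hψ.continuous) ((hi _ hψ.continuous).mul_const c)]
      exact intervalIntegral.integral_congr fun x _ => by ring
    rw [e2, ← e1, h4]
  have hae : ∀ᵐ x, x ∈ Ioo (0 : ℝ) 1 → h x - c = 0 := by
    refine isOpen_Ioo.ae_eq_zero_of_integral_contDiff_smul_eq_zero ?_ ?_
    · exact ((hc.mono Ioo_subset_Icc_self).sub continuousOn_const).locallyIntegrableOn
        measurableSet_Ioo
    · intro g hg _ hgs
      rw [← key g hg hgs, intervalIntegral.integral_of_le zero_le_one,
        setIntegral_eq_integral_of_forall_compl_eq_zero]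
      · rfl
      · intro x hx
        rw [image_eq_zero_of_notMem_tsupport fun h' => hx (Ioo_subset_Ioc_self (hgs h')), zero_mul]
  have hall : EqOn h (fun _ => c) (Icc 0 1) := by
    have : EqOn h (fun _ => c) (Ioo 0 1) := by
      refine MeasureTheory.Measure.eqOn_open_of_ae_eq (μ := volume) ?_ isOpen_Ioo
        (hc.mono Ioo_subset_Icc_self) continuousOn_const
      rw [Filter.EventuallyEq, ae_restrict_iff' measurableSet_Ioo]
      filter_upwards [hae] with x hx hx'
      linarith [hx hx']
    refine this.of_subset_closure hc continuousOn_const Ioo_subset_Icc_self ?_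
    rw [closure_Ioo (by norm_num)]
  intro x hx
  rw [hall hx, hall (left_mem_Icc.2 zero_le_one)]

/-- A continuous real function with integrable weak derivative is a primitive of the latter. -/
theorem sub_eq_integral_of_real_weak_deriv {f g : ℝ → ℝ} (hf : ContinuousOn f (Icc 0 1))
    (hg : IntervalIntegrable g volume 0 1)
    (hw : ∀ φ : ℝ → ℝ, ContDiff ℝ ∞ φ → tsupport φ ⊆ Ioo 0 1 →
      ∫ x in (0 : ℝ)..1, deriv φ x * f x = -∫ x in (0 : ℝ)..1, φ x * g x) :
    ∀ x ∈ Icc (0 : ℝ) 1, f x - f 0 = ∫ t in (0 : ℝ)..x, g t := by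
  -- The primitive of `g` is absolutely continuous, so it can be integrated by parts against test
  -- functions; `f` minus this primitive then has weak derivative zero and du Bois-Reymond applies.
  have hac := hg.absolutelyContinuousOnInterval_intervalIntegral (c := 0) left_mem_uIcc
  have hFc := hac.continuousOn
  have hfc : ContinuousOn f (uIcc 0 1) := by rwa [uIcc_of_le zero_le_one]
  have := eqOn_const_of_integral_deriv_mul_eq_zero
    (h := fun x => f x - ∫ t in (0 : ℝ)..x, g t) (hf.sub (by rwa [uIcc_of_le zero_le_one] at hFc))
    (by
      intro φ hφ hφs
      have hdc : Continuous (deriv φ) := hφ.continuous_deriv (by simp)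
      have hz : ∀ x, x ∉ Ioo (0 : ℝ) 1 → φ x = 0 := fun x hx =>
        image_eq_zero_of_notMem_tsupport fun h => hx (hφs h)
      have ibp := AbsolutelyContinuousOnInterval.integral_mul_deriv_eq_deriv_mul
        ((hφ.of_le (by simp)).contDiffOn.absolutelyContinuousOnInterval) hac
      rw [hz 0 (by simp), hz 1 (by simp), zero_mul, zero_mul, sub_zero, zero_sub] at ibp
      have hder : ∫ x in (0 : ℝ)..1, φ x * deriv (fun x => ∫ t in (0 : ℝ)..x, g t) x
          = ∫ x in (0 : ℝ)..1, φ x * g x := by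
        refine intervalIntegral.integral_congr_ae ?_
        filter_upwards [hg.ae_hasDerivAt_integral] with x hx hx'
        rw [(hx (uIoc_subset_uIcc hx') 0 left_mem_uIcc).deriv]
      have e : ∫ x in (0 : ℝ)..1, deriv φ x * (f x - ∫ t in (0 : ℝ)..x, g t)
          = (∫ x in (0 : ℝ)..1, deriv φ x * f x)
            - ∫ x in (0 : ℝ)..1, deriv φ x * ∫ t in (0 : ℝ)..x, g t := by
        have hint : ∀ u : ℝ → ℝ, ContinuousOn u (uIcc 0 1) →
            IntervalIntegrable (fun x => deriv φ x * u x) volume 0 1 :=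
          fun u hu => (hdc.continuousOn.mul hu).intervalIntegrable
        rw [← intervalIntegral.integral_sub (hint _ hfc) (hint _ hFc)]
        exact intervalIntegral.integral_congr fun x _ => by ring
      rw [e, hw φ hφ hφs, ← hder, ibp]
      ring)
  intro x hx
  have h := this x hx
  simp only [intervalIntegral.integral_same] at h
  linarith

/-- A continuous curve with integrable weak derivative is a primitive of the latter. -/
theorem HasWeakDeriv.sub_eq_integral {f g : ℝ → Plane} (hw : HasWeakDeriv f g)
    (hf : ContinuousOn f (Icc 0 1)) (hg : IntervalIntegrable g volume 0 1) {x y : ℝ}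
    (hx : x ∈ Icc (0 : ℝ) 1) (hy : y ∈ Icc (0 : ℝ) 1) :
    f y - f x = ∫ t in x..y, g t := by
  have hfc : ContinuousOn f (uIcc 0 1) := by rwa [uIcc_of_le zero_le_one]
  have hgi : ∀ z ∈ Icc (0 : ℝ) 1, IntervalIntegrable g volume 0 z := fun z hz =>
    hg.mono_set (by rw [uIcc_of_le hz.1, uIcc_of_le zero_le_one]; exact Icc_subset_Icc_right hz.2)
  have key : ∀ z ∈ Icc (0 : ℝ) 1, f z - f 0 = ∫ t in (0 : ℝ)..z, g t := by
    intro z hz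
    refine ext_inner_left ℝ fun e => ?_
    have hI : ∀ (u : ℝ → Plane) (z : ℝ), IntervalIntegrable u volume 0 z →
        ∫ t in (0 : ℝ)..z, inner ℝ e (u t) = inner ℝ e (∫ t in (0 : ℝ)..z, u t) := fun u z hu =>
      (innerSL ℝ e).intervalIntegral_comp_comm hu
    rw [← hI g z (hgi z hz), inner_sub_right]
    refine sub_eq_integral_of_real_weak_deriv (f := fun x => inner ℝ e (f x))
      (g := fun x => inner ℝ e (g x)) (continuousOn_const.inner hf) ?_ ?_ z hz
    · exact ⟨hg.1.const_inner e, hg.2.const_inner e⟩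
    · intro φ hφ hφs
      have hdc : Continuous (deriv φ) := hφ.continuous_deriv (by simp)
      have h1 := hI (fun x => deriv φ x • f x) 1
        (hdc.continuousOn.smul hfc).intervalIntegrable
      have h2 := hI (fun x => φ x • g x) 1
        (hg.continuousOn_smul hφ.continuous.continuousOn)
      simp only [inner_smul_right] at h1 h2
      rw [h1, h2, hw φ hφ hφs, inner_neg_right]
  have h := intervalIntegral.integral_add_adjacent_intervals (hgi x hx).symm (hgi y hy)
  rw [intervalIntegral.integral_symm, ← key x hx, ← key y hy] at h
  rw [← h]; abel

/-- The Cauchy-Schwarz inequality for the integral of a square integrable function over a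
subinterval of `(0,1)`. -/
theorem norm_intervalIntegral_sq_le {g : ℝ → Plane} (hg : MemLp g 2 (volume.restrict (Ioo 0 1)))
    {x y : ℝ} (hx : x ∈ Icc (0 : ℝ) 1) (hy : y ∈ Icc (0 : ℝ) 1) :
    ‖∫ t in x..y, g t‖ ^ 2 ≤ |x - y| * ∫ t in (0 : ℝ)..1, ‖g t‖ ^ 2 := by
  wlog hxy : x < y generalizing x y
  · rcases (not_lt.1 hxy).eq_or_lt with h | h
    · simp [h]
    · rw [intervalIntegral.integral_symm, norm_neg, abs_sub_comm]
      exact this hy hx h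
  have hsub : Ioo x y ⊆ Ioo 0 1 := Ioo_subset_Ioo hx.1 hy.2
  have hg1 : IntervalIntegrable (fun t => ‖g t‖) volume x y := by
    rw [intervalIntegrable_iff_integrableOn_Ioo_of_le hxy.le]
    exact IntegrableOn.mono_set (hg.integrable (by norm_num)).norm hsub
  have hg2' : IntervalIntegrable (fun t => ‖g t‖ ^ 2) volume 0 1 := by
    rw [intervalIntegrable_iff_integrableOn_Ioo_of_le zero_le_one]
    exact (memLp_two_iff_integrable_sq_norm hg.1).1 hg
  have hg2 : IntervalIntegrable (fun t => ‖g t‖ ^ 2) volume x y :=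
    hg2'.mono_set (by
      rw [uIcc_of_le hxy.le, uIcc_of_le zero_le_one]; exact Icc_subset_Icc hx.1 hy.2)
  have hmono : ∫ t in x..y, ‖g t‖ ^ 2 ≤ ∫ t in (0 : ℝ)..1, ‖g t‖ ^ 2 :=
    intervalIntegral.integral_mono_interval hx.1 hxy.le hy.2
      (Eventually.of_forall fun t => by positivity) hg2'
  set I := ∫ t in x..y, ‖g t‖ with hI
  set B := ∫ t in x..y, ‖g t‖ ^ 2 with hB
  have hd : 0 < y - x := by linarith
  set m := I / (y - x) with hm
  -- With `m` the mean of `‖g‖` on the interval, nonnegativity of this variance is exactly the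
  -- Cauchy-Schwarz inequality `I ^ 2 ≤ (y - x) * B`.
  have hexp : ∫ t in x..y, (‖g t‖ - m) ^ 2 = B - 2 * m * I + m ^ 2 * (y - x) := by
    have : ∫ t in x..y, (‖g t‖ - m) ^ 2
        = ∫ t in x..y, (‖g t‖ ^ 2 - 2 * m * ‖g t‖) + m ^ 2 :=
      intervalIntegral.integral_congr fun t _ => by ring
    rw [this, intervalIntegral.integral_add (hg2.sub (hg1.const_mul _)) (by simp),
      intervalIntegral.integral_sub hg2 (hg1.const_mul _), intervalIntegral.integral_const_mul,
      intervalIntegral.integral_const, smul_eq_mul]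
    ring
  have hpos : 0 ≤ ∫ t in x..y, (‖g t‖ - m) ^ 2 :=
    intervalIntegral.integral_nonneg hxy.le fun t _ => by positivity
  have hmI : m * (y - x) = I := by rw [hm]; field_simp
  have hIB : I ^ 2 ≤ (y - x) * B := by
    rw [hexp] at hpos
    nlinarith
  have hnorm : ‖∫ t in x..y, g t‖ ≤ I := intervalIntegral.norm_integral_le_integral_norm hxy.le
  rw [abs_sub_comm, abs_of_pos hd]
  calc ‖∫ t in x..y, g t‖ ^ 2 ≤ I ^ 2 := by gcongr
    _ ≤ (y - x) * B := hIB
    _ ≤ _ := by gcongr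

/-! ### Curves controlled by their energy -/

namespace H2Curve

variable (c : H2Curve)

theorem intervalIntegrable_vel : IntervalIntegrable c.vel volume 0 1 :=
  ContinuousOn.intervalIntegrable (by rw [uIcc_of_le zero_le_one]; exact c.continuousOn_vel)

theorem intervalIntegrable_acc : IntervalIntegrable c.acc volume 0 1 := by
  rw [intervalIntegrable_iff_integrableOn_Ioo_of_le zero_le_one]
  exact c.memLp_acc.integrable (by norm_num)

variable {c}

theorem pos_sub_pos {x y : ℝ} (hx : x ∈ Icc (0 : ℝ) 1) (hy : y ∈ Icc (0 : ℝ) 1) :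
    c.pos y - c.pos x = ∫ t in x..y, c.vel t :=
  c.weak_vel.sub_eq_integral c.continuousOn_pos c.intervalIntegrable_vel hx hy

theorem vel_sub_vel {x y : ℝ} (hx : x ∈ Icc (0 : ℝ) 1) (hy : y ∈ Icc (0 : ℝ) 1) :
    c.vel y - c.vel x = ∫ t in x..y, c.acc t :=
  c.weak_acc.sub_eq_integral c.continuousOn_vel c.intervalIntegrable_acc hx hy

theorem length_nonneg : 0 ≤ c.length :=
  intervalIntegral.integral_nonneg zero_le_one fun _ _ => norm_nonneg _

theorem integral_acc_sq_nonneg : 0 ≤ ∫ x in (0 : ℝ)..1, ‖c.acc x‖ ^ 2 :=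
  intervalIntegral.integral_nonneg zero_le_one fun _ _ => by positivity

theorem energy_nonneg : 0 ≤ c.energy := by
  have := c.length_nonneg
  have := c.integral_acc_sq_nonneg
  unfold energy
  positivity

/-- A curve of constant speed whose length is at most `M` and whose second derivative is
controlled by its length. -/
structure Controlled (M : ℝ) (c : H2Curve) : Prop where
  norm_vel : ∀ x ∈ Icc (0 : ℝ) 1, ‖c.vel x‖ = c.length
  length_le : c.length ≤ M
  integral_acc_sq_le : ∫ x in (0 : ℝ)..1, ‖c.acc x‖ ^ 2 ≤ M * c.length ^ 3

theorem controlled_of_energy_le {M : ℝ} (hr : c.IsRegular)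
    (hs : ∀ x ∈ Icc (0 : ℝ) 1, ‖c.vel x‖ = c.length) (hE : c.energy ≤ M) : Controlled M c := by
  have h0 : (0 : ℝ) ∈ Icc (0 : ℝ) 1 := by simp
  have hL : 0 < c.length := by
    rw [← hs 0 h0]; exact norm_pos_iff.2 (hr 0 h0)
  have hA := c.integral_acc_sq_nonneg
  unfold energy at hE
  refine ⟨hs, le_trans ?_ hE, ?_⟩
  · have : 0 ≤ 1 / c.length ^ 3 * ∫ x in (0 : ℝ)..1, ‖c.acc x‖ ^ 2 := by positivity
    linarith
  · have h1 : 1 / c.length ^ 3 * (∫ x in (0 : ℝ)..1, ‖c.acc x‖ ^ 2) ≤ M := by linarith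
    rwa [one_div, inv_mul_le_iff₀ (by positivity), mul_comm] at h1

theorem vel_eq_zero_of_length_eq_zero (h : c.length = 0) : ∀ x ∈ Icc (0 : ℝ) 1, c.vel x = 0 := by
  intro x hx
  by_contra hne
  have : 0 < c.length := by
    unfold length
    refine intervalIntegral.integral_pos zero_lt_one c.continuousOn_vel.norm
      (fun _ _ => norm_nonneg _) ⟨x, hx, norm_pos_iff.2 hne⟩
  exact this.ne' h

/-- The velocity vanishes identically, hence so does its weak derivative almost everywhere. This
lets the collapsed curve of a degenerate network be treated like the others in the compactness
argument. -/
theorem controlled_of_length_eq_zero {M : ℝ} (hM : 0 ≤ M) (h : c.length = 0) :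
    Controlled M c := by
  have hv := vel_eq_zero_of_length_eq_zero h
  refine ⟨fun x hx => by rw [hv x hx, h, norm_zero], by rwa [h], ?_⟩
  have hae : ∀ᵐ x, x ∈ Ioo (0 : ℝ) 1 → c.acc x = 0 := by
    refine isOpen_Ioo.ae_eq_zero_of_integral_contDiff_smul_eq_zero ?_ ?_
    · have h' : IntegrableOn c.acc (Ioo 0 1) volume := c.memLp_acc.integrable (by norm_num)
      exact h'.locallyIntegrableOn
    · intro g hg _ hgs
      have h1 := c.weak_acc g hg hgs
      rw [intervalIntegral.integral_congr (g := fun _ => (0 : Plane)),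
        intervalIntegral.integral_zero] at h1
      · rw [← neg_eq_zero, h1, intervalIntegral.integral_of_le zero_le_one,
          setIntegral_eq_integral_of_forall_compl_eq_zero]
        intro x hx
        rw [image_eq_zero_of_notMem_tsupport fun h' => hx (Ioo_subset_Ioc_self (hgs h')),
          zero_smul]
      · intro x hx
        rw [uIcc_of_le zero_le_one] at hx
        simp [hv x hx]
  rw [intervalIntegral.integral_of_le zero_le_one, integral_Ioc_eq_integral_Ioo,
    setIntegral_congr_ae (g := fun _ => (0 : ℝ)) measurableSet_Ioo]
  · simp [h]
  · filter_upwards [hae] with x hx hx'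
    simp [hx hx']

namespace Controlled

variable {M : ℝ}

theorem nonneg (h : Controlled M c) : 0 ≤ M := c.length_nonneg.trans h.length_le

theorem integral_acc_sq_le' (h : Controlled M c) :
    ∫ x in (0 : ℝ)..1, ‖c.acc x‖ ^ 2 ≤ (M ^ 2) ^ 2 := by
  refine h.integral_acc_sq_le.trans ?_
  have := h.nonneg
  calc M * c.length ^ 3 ≤ M * M ^ 3 := by gcongr; exacts [c.length_nonneg, h.length_le]
    _ = _ := by ring

theorem norm_vel_sub_le_of (h : Controlled M c) {x y : ℝ} (hx : x ∈ Icc (0 : ℝ) 1)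
    (hy : y ∈ Icc (0 : ℝ) 1) : ‖c.vel x - c.vel y‖ ≤ M ^ 2 * √|x - y| := by
  refine abs_le_of_sq_le_sq' ?_ (by positivity) |>.2
  rw [mul_pow, Real.sq_sqrt (abs_nonneg _), vel_sub_vel hy hx, mul_comm, abs_sub_comm]
  refine (norm_intervalIntegral_sq_le c.memLp_acc hy hx).trans ?_
  gcongr
  exact h.integral_acc_sq_le'

/-- Cauchy-Schwarz with `|y - x| ≤ 1` and `M * L ^ 3 = L ^ 2 * (M * L)`. The factor `L` is kept
outside so that, after division by the speed, the bound for unit tangents still tends to zero with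
the length. -/
theorem norm_vel_sub_le_length_mul (h : Controlled M c) {x y : ℝ} (hx : x ∈ Icc (0 : ℝ) 1)
    (hy : y ∈ Icc (0 : ℝ) 1) : ‖c.vel x - c.vel y‖ ≤ c.length * √(M * c.length) := by
  have hL := c.length_nonneg
  have hM := h.nonneg
  refine abs_le_of_sq_le_sq' ?_ (by positivity) |>.2
  rw [mul_pow, Real.sq_sqrt (by positivity), vel_sub_vel hy hx]
  refine (norm_intervalIntegral_sq_le c.memLp_acc hy hx).trans ?_
  have h1 : |y - x| ≤ 1 := by
    rw [abs_le]; constructor <;> linarith [hx.1, hx.2, hy.1, hy.2]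
  calc _ ≤ 1 * ∫ t in (0 : ℝ)..1, ‖c.acc t‖ ^ 2 := by
        gcongr; exact c.integral_acc_sq_nonneg
    _ ≤ M * c.length ^ 3 := by rw [one_mul]; exact h.integral_acc_sq_le
    _ = _ := by ring

/-- The chord of a curve is close to its initial velocity. -/
theorem norm_chord_sub_vel_le (h : Controlled M c) :
    ‖c.pos 1 - c.pos 0 - c.vel 0‖ ≤ c.length * √(M * c.length) := by
  have h0 : (0 : ℝ) ∈ Icc (0 : ℝ) 1 := by simp
  have h1 : (1 : ℝ) ∈ Icc (0 : ℝ) 1 := by simp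
  have e : c.pos 1 - c.pos 0 - c.vel 0 = ∫ t in (0 : ℝ)..1, (c.vel t - c.vel 0) := by
    rw [intervalIntegral.integral_sub c.intervalIntegrable_vel (by simp), pos_sub_pos h0 h1]
    simp
  rw [e]
  refine (intervalIntegral.norm_integral_le_of_norm_le_const (C := c.length * √(M * c.length))
    fun t ht => ?_).trans (by simp)
  rw [uIoc_of_le zero_le_one] at ht
  exact h.norm_vel_sub_le_length_mul (Ioc_subset_Icc_self ht) h0

theorem norm_pos_sub_le (h : Controlled M c) {x y : ℝ} (hx : x ∈ Icc (0 : ℝ) 1)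
    (hy : y ∈ Icc (0 : ℝ) 1) : ‖c.pos y - c.pos x‖ ≤ M := by
  rw [pos_sub_pos hx hy]
  have hM := h.nonneg
  have h1 : |y - x| ≤ 1 := by
    rw [abs_le]; constructor <;> linarith [hx.1, hx.2, hy.1, hy.2]
  refine (intervalIntegral.norm_integral_le_of_norm_le_const (C := M) fun t ht => ?_).trans ?_
  · rw [h.norm_vel t ?_]
    · exact h.length_le
    · exact uIcc_subset_Icc hx hy (uIoc_subset_uIcc ht)
  · nlinarith

end Controlled

end H2Curve

/-! ### Weak compactness and passage to the limit -/

theorem intervalIntegral_zero_one_eq {E : Type*} [NormedAddCommGroup E] [NormedSpace ℝ E]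
    (f : ℝ → E) : ∫ x in (0 : ℝ)..1, f x = ∫ x in Ioo 0 1, f x := by
  rw [intervalIntegral.integral_of_le zero_le_one, integral_Ioc_eq_integral_Ioo]

/-- Bounded sequences in a separable Hilbert space have weakly convergent subsequences. -/
theorem exists_subseq_tendsto_inner {H : Type*} [NormedAddCommGroup H] [InnerProductSpace ℝ H]
    [CompleteSpace H] [TopologicalSpace.SeparableSpace H] {C : ℝ} (a : ℕ → H)
    (ha : ∀ n, ‖a n‖ ≤ C) :
    ∃ φ : ℕ → ℕ, StrictMono φ ∧ ∃ b : H, ∀ d : H,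
      Tendsto (fun n => inner ℝ (a (φ n)) d) atTop (𝓝 (inner ℝ b d)) := by
  -- Sequential Banach-Alaoglu in the dual, transported to `H` by the Riesz isometry.
  have h := WeakDual.isSeqCompact_closedBall ℝ H (0 : StrongDual ℝ H) C
  obtain ⟨b, -, φ, hφ, hb⟩ := h
    (x := fun n => StrongDual.toWeakDual (InnerProductSpace.toDual ℝ H (a n))) (fun n => by
      simpa using ha n)
  refine ⟨φ, hφ, (InnerProductSpace.toDual ℝ H).symm (WeakDual.toStrongDual b), fun d => ?_⟩
  have := ((WeakDual.eval_continuous d).tendsto b).comp hb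
  rw [InnerProductSpace.toDual_symm_apply]
  exact this

/-- Weak sequential compactness in `L²((0,1); ℝ²)`. -/
theorem exists_subseq_tendsto_integral_inner {C : ℝ} (hC : 0 ≤ C) (a : ℕ → ℝ → Plane)
    (ha : ∀ n, MemLp (a n) 2 (volume.restrict (Ioo 0 1)))
    (hb : ∀ n, ∫ x in (0 : ℝ)..1, ‖a n x‖ ^ 2 ≤ C ^ 2) :
    ∃ φ : ℕ → ℕ, StrictMono φ ∧ ∃ b : ℝ → Plane, MemLp b 2 (volume.restrict (Ioo 0 1)) ∧
      ∀ d : ℝ → Plane, MemLp d 2 (volume.restrict (Ioo 0 1)) →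
        Tendsto (fun n => ∫ x in (0 : ℝ)..1, inner ℝ (a (φ n) x) (d x)) atTop
          (𝓝 (∫ x in (0 : ℝ)..1, inner ℝ (b x) (d x))) := by
  have : Fact ((2 : ℝ≥0∞) ≠ ⊤) := ⟨by norm_num⟩
  have hin : ∀ {f g : ℝ → Plane} (hf : MemLp f 2 (volume.restrict (Ioo 0 1)))
      (hg : MemLp g 2 (volume.restrict (Ioo 0 1))),
      inner ℝ (hf.toLp f) (hg.toLp g) = ∫ x in (0 : ℝ)..1, inner ℝ (f x) (g x) := by
    intro f g hf hg
    rw [L2.inner_def, intervalIntegral_zero_one_eq]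
    refine integral_congr_ae ?_
    filter_upwards [hf.coeFn_toLp, hg.coeFn_toLp] with x h1 h2
    rw [h1, h2]
  obtain ⟨φ, hφ, b, h⟩ := exists_subseq_tendsto_inner (C := C) (fun n => (ha n).toLp (a n)) (by
    intro n
    refine abs_le_of_sq_le_sq' ?_ hC |>.2
    rw [← real_inner_self_eq_norm_sq, hin]
    simpa only [real_inner_self_eq_norm_sq] using hb n)
  refine ⟨φ, hφ, b, Lp.memLp b, fun d hd => ?_⟩
  have h' := h (hd.toLp d)
  rw [← Lp.toLp_coeFn b (Lp.memLp b)] at h'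
  simpa only [hin] using h'

/-- In the plane, weak convergence implies convergence. -/
theorem tendsto_of_forall_tendsto_inner {ι : Type*} {l : Filter ι} {u : ι → Plane} {v : Plane}
    (h : ∀ e : Plane, Tendsto (fun n => inner ℝ (u n) e) l (𝓝 (inner ℝ v e))) :
    Tendsto u l (𝓝 v) := by
  have := tendsto_finsetSum Finset.univ fun i _ =>
    (h (EuclideanSpace.basisFun (Fin 2) ℝ i)).smul_const (EuclideanSpace.basisFun (Fin 2) ℝ i)
  simp only [fun x i => real_inner_comm (EuclideanSpace.basisFun (Fin 2) ℝ i) x,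
    OrthonormalBasis.sum_repr'] at this
  exact this

/-- Weak derivatives are stable under weak convergence. -/
theorem hasWeakDeriv_of_tendsto {f g : ℕ → ℝ → Plane} {f' g' : ℝ → Plane}
    (hw : ∀ n, HasWeakDeriv (f n) (g n))
    (hf : ∀ n, IntervalIntegrable (f n) volume 0 1)
    (hg : ∀ n, IntervalIntegrable (g n) volume 0 1)
    (hf' : IntervalIntegrable f' volume 0 1) (hg' : IntervalIntegrable g' volume 0 1)
    (hft : ∀ v : ℝ → Plane, Continuous v →
      Tendsto (fun n => ∫ x in (0 : ℝ)..1, inner ℝ (f n x) (v x)) atTop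
        (𝓝 (∫ x in (0 : ℝ)..1, inner ℝ (f' x) (v x))))
    (hgt : ∀ v : ℝ → Plane, Continuous v →
      Tendsto (fun n => ∫ x in (0 : ℝ)..1, inner ℝ (g n x) (v x)) atTop
        (𝓝 (∫ x in (0 : ℝ)..1, inner ℝ (g' x) (v x)))) :
    HasWeakDeriv f' g' := by
  intro φ hφ hφs
  have hdc : Continuous (deriv φ) := hφ.continuous_deriv (by simp)
  have hI : ∀ (ψ : ℝ → ℝ) (u : ℝ → Plane) (e : Plane), Continuous ψ →
      IntervalIntegrable u volume 0 1 →
      inner ℝ (∫ x in (0 : ℝ)..1, ψ x • u x) e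
        = ∫ x in (0 : ℝ)..1, inner ℝ (u x) (ψ x • e) := by
    intro ψ u e hψ hu
    rw [real_inner_comm]
    have := (innerSL ℝ e).intervalIntegral_comp_comm (hu.continuousOn_smul hψ.continuousOn)
    simp only [innerSL_apply_apply] at this
    rw [← this]
    refine intervalIntegral.integral_congr fun x _ => ?_
    simp only [inner_smul_right, real_inner_comm]
  have hconv : ∀ (ψ : ℝ → ℝ) (u : ℕ → ℝ → Plane) (u' : ℝ → Plane), Continuous ψ →
      (∀ n, IntervalIntegrable (u n) volume 0 1) → IntervalIntegrable u' volume 0 1 →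
      (∀ v : ℝ → Plane, Continuous v →
        Tendsto (fun n => ∫ x in (0 : ℝ)..1, inner ℝ (u n x) (v x)) atTop
          (𝓝 (∫ x in (0 : ℝ)..1, inner ℝ (u' x) (v x)))) →
      Tendsto (fun n => ∫ x in (0 : ℝ)..1, ψ x • u n x) atTop
        (𝓝 (∫ x in (0 : ℝ)..1, ψ x • u' x)) := by
    intro ψ u u' hψ hu hu' ht
    refine tendsto_of_forall_tendsto_inner fun e => ?_
    simp only [hI ψ _ e hψ hu', fun n => hI ψ (u n) e hψ (hu n)]
    exact ht _ (hψ.smul continuous_const)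
  have h1 := hconv _ f f' hdc hf hf' hft
  have h2 := (hconv _ g g' hφ.continuous hg hg' hgt).neg
  refine tendsto_nhds_unique h1 (h2.congr fun n => ?_)
  rw [hw n φ hφ hφs]

/-- Equi-Hölder functions that converge to zero pointwise converge to zero uniformly. -/
theorem eventually_norm_le_of_holder {w : ℕ → ℝ → Plane} {C : ℝ}
    (hH : ∀ n, ∀ x ∈ Icc (0 : ℝ) 1, ∀ y ∈ Icc (0 : ℝ) 1, ‖w n x - w n y‖ ≤ C * √|x - y|)
    (hp : ∀ x ∈ Icc (0 : ℝ) 1, Tendsto (fun n => w n x) atTop (𝓝 0)) {ε : ℝ} (hε : 0 < ε) :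
    ∀ᶠ n in atTop, ∀ x ∈ Icc (0 : ℝ) 1, ‖w n x‖ ≤ ε := by
  obtain ⟨δ, hδ, hCδ⟩ : ∃ δ : ℝ, 0 < δ ∧ |C| * √δ ≤ ε / 2 := by
    have : Tendsto (fun δ : ℝ => |C| * √δ) (𝓝[>] 0) (𝓝 0) := by
      have h : Continuous fun δ : ℝ => |C| * √δ := by fun_prop
      simpa using (h.tendsto 0).mono_left nhdsWithin_le_nhds
    obtain ⟨δ, h1, h2⟩ := ((this.eventually_le_const (half_pos hε)).and
      self_mem_nhdsWithin).exists
    exact ⟨δ, h2, h1⟩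
  -- Pointwise convergence is uniform on a finite `δ`-net, and the common Hölder bound carries it to
  -- all other points.
  obtain ⟨t, hts, htf, hcov⟩ := finite_cover_balls_of_compact
    (isCompact_Icc (a := (0 : ℝ)) (b := 1)) hδ
  have hev : ∀ᶠ n in atTop, ∀ z ∈ t, ‖w n z‖ ≤ ε / 2 := by
    rw [htf.eventually_all]
    intro z hz
    have := (hp z (hts hz)).norm
    rw [norm_zero] at this
    exact this.eventually_le_const (half_pos hε)
  filter_upwards [hev] with n hn x hx
  obtain ⟨z, hz, hxz⟩ := mem_iUnion₂.1 (hcov hx)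
  have h1 := hH n x hx z (hts hz)
  have h2 : C * √|x - z| ≤ |C| * √δ := by
    have : |x - z| ≤ δ := by rw [← Real.dist_eq]; exact (Metric.mem_ball.1 hxz).le
    gcongr
    exact le_abs_self C
  have h3 := norm_add_le (w n x - w n z) (w n z)
  rw [sub_add_cancel] at h3
  linarith [hn z hz]

/-- Integrals of inner products with a fixed continuous function pass to bounded pointwise
limits. -/
theorem tendsto_integral_inner_of_pointwise {u : ℕ → ℝ → Plane} {u' v : ℝ → Plane} {C : ℝ}
    (hu : ∀ n, ContinuousOn (u n) (Icc 0 1)) (hb : ∀ n, ∀ x ∈ Icc (0 : ℝ) 1, ‖u n x‖ ≤ C)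
    (ht : ∀ x ∈ Icc (0 : ℝ) 1, Tendsto (fun n => u n x) atTop (𝓝 (u' x)))
    (hv : ContinuousOn v (Icc 0 1)) :
    Tendsto (fun n => ∫ x in (0 : ℝ)..1, inner ℝ (u n x) (v x)) atTop
      (𝓝 (∫ x in (0 : ℝ)..1, inner ℝ (u' x) (v x))) := by
  have hI : uIoc (0 : ℝ) 1 ⊆ Icc 0 1 := by
    rw [uIoc_of_le zero_le_one]; exact Ioc_subset_Icc_self
  refine intervalIntegral.tendsto_integral_filter_of_dominated_convergence
    (fun x => C * ‖v x‖) ?_ ?_ ?_ ?_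
  · exact Eventually.of_forall fun n =>
      (((hu n).inner hv).mono hI).aestronglyMeasurable measurableSet_uIoc
  · refine Eventually.of_forall fun n => Eventually.of_forall fun x hx => ?_
    refine (norm_inner_le_norm _ _).trans ?_
    gcongr
    exact hb n x (hI hx)
  · refine ContinuousOn.intervalIntegrable ?_
    rw [uIcc_of_le zero_le_one]
    exact continuousOn_const.mul hv.norm
  · exact Eventually.of_forall fun x hx => (ht x (hI hx)).inner tendsto_const_nhds

theorem MeasureTheory.memLp_two_of_continuousOn {f : ℝ → Plane} (hf : ContinuousOn f (Icc 0 1)) :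
    MemLp f 2 (volume.restrict (Ioo 0 1)) := by
  obtain ⟨C, hC⟩ := isCompact_Icc.exists_bound_of_continuousOn hf
  refine MemLp.of_bound ((hf.mono Ioo_subset_Icc_self).aestronglyMeasurable measurableSet_Ioo) C ?_
  rw [ae_restrict_iff' measurableSet_Ioo]
  exact Eventually.of_forall fun x hx => hC x (Ioo_subset_Icc_self hx)

/-- Weak convergence in `L²(0,1)` implies convergence of the primitives. -/
theorem tendsto_primitive_of_weak {a : ℕ → ℝ → Plane} {b : ℝ → Plane}
    (ha : ∀ n, MemLp (a n) 2 (volume.restrict (Ioo 0 1)))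
    (hb : MemLp b 2 (volume.restrict (Ioo 0 1)))
    (h : ∀ d : ℝ → Plane, MemLp d 2 (volume.restrict (Ioo 0 1)) →
        Tendsto (fun n => ∫ x in (0 : ℝ)..1, inner ℝ (a n x) (d x)) atTop
          (𝓝 (∫ x in (0 : ℝ)..1, inner ℝ (b x) (d x))))
    {x : ℝ} (hx : x ∈ Icc (0 : ℝ) 1) :
    Tendsto (fun n => ∫ t in (0 : ℝ)..x, a n t) atTop (𝓝 (∫ t in (0 : ℝ)..x, b t)) := by
  refine tendsto_of_forall_tendsto_inner fun e => ?_
  -- A component of the primitive at `x` is the `L²` pairing with `e` cut off at `x`. This test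
  -- function is discontinuous, so convergence is needed against all of `L²`.
  have key : ∀ f : ℝ → Plane, MemLp f 2 (volume.restrict (Ioo 0 1)) →
      inner ℝ (∫ t in (0 : ℝ)..x, f t) e
        = ∫ t in (0 : ℝ)..1, inner ℝ (f t) ((Iio x).indicator (fun _ => e) t) := by
    intro f hf
    have hfi : IntegrableOn f (Ioo 0 x) volume :=
      IntegrableOn.mono_set (hf.integrable (by norm_num)) (Ioo_subset_Ioo_right hx.2)
    have e1 : (fun t => inner ℝ (f t) ((Iio x).indicator (fun _ => e) t))
        = (Iio x).indicator (fun t => inner ℝ e (f t)) := by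
      funext t
      by_cases ht : t ∈ Iio x
      · simp only [indicator_of_mem ht, real_inner_comm]
      · simp only [indicator_of_notMem ht, inner_zero_right]
    rw [e1, intervalIntegral_zero_one_eq, setIntegral_indicator measurableSet_Iio, Ioo_inter_Iio,
      min_eq_right hx.2, integral_inner hfi, intervalIntegral.integral_of_le hx.1,
      integral_Ioc_eq_integral_Ioo, real_inner_comm]
  simp only [key b hb, fun n => key (a n) (ha n)]
  exact h _ ((memLp_const e).indicator measurableSet_Iio)

/-! ### Compactness of controlled curves -/

namespace H2Curve

/-- Convergence of curves weakly in `H²`, strongly in `C^{1,α}` for all `α < 1/2`, and pointwise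
together with the velocities. -/
structure ConvergesTo (c : ℕ → H2Curve) (c' : H2Curve) : Prop where
  weak : WeakTendsto c c'
  holder : ∀ α : ℝ, 0 < α → α < 1 / 2 → Tendsto (fun n => holderDist α (c n) c') atTop (𝓝 0)
  pos : ∀ x ∈ Icc (0 : ℝ) 1, Tendsto (fun n => (c n).pos x) atTop (𝓝 (c'.pos x))
  vel : ∀ x ∈ Icc (0 : ℝ) 1, Tendsto (fun n => (c n).vel x) atTop (𝓝 (c'.vel x))

theorem ConvergesTo.comp {c : ℕ → H2Curve} {c' : H2Curve} (h : ConvergesTo c c') {φ : ℕ → ℕ}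
    (hφ : StrictMono φ) : ConvergesTo (fun n => c (φ n)) c' :=
  ⟨fun d => (h.weak d).comp hφ.tendsto_atTop,
    fun α h0 h1 => (h.holder α h0 h1).comp hφ.tendsto_atTop,
    fun x hx => (h.pos x hx).comp hφ.tendsto_atTop,
    fun x hx => (h.vel x hx).comp hφ.tendsto_atTop⟩

/-- Uniform convergence together with a `1/2`-Hölder bound implies convergence in `C^{1,α}`. -/
theorem tendsto_holderDist {c : ℕ → H2Curve} {c' : H2Curve} {C : ℝ} (hC : 0 ≤ C)
    (hH : ∀ n, ∀ x ∈ Icc (0 : ℝ) 1, ∀ y ∈ Icc (0 : ℝ) 1,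
      ‖((c n).vel x - c'.vel x) - ((c n).vel y - c'.vel y)‖ ≤ C * √|x - y|)
    (hp : ∀ ε > 0, ∀ᶠ n in atTop, ∀ x ∈ Icc (0 : ℝ) 1, ‖(c n).pos x - c'.pos x‖ ≤ ε)
    (hv : ∀ ε > 0, ∀ᶠ n in atTop, ∀ x ∈ Icc (0 : ℝ) 1, ‖(c n).vel x - c'.vel x‖ ≤ ε)
    {α : ℝ} (h0 : 0 < α) (h1 : α < 1 / 2) :
    Tendsto (fun n => holderDist α (c n) c') atTop (𝓝 0) := by
  have hsup : ∀ u : ℕ → ℝ → Plane,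
      (∀ ε > 0, ∀ᶠ n in atTop, ∀ x ∈ Icc (0 : ℝ) 1, ‖u n x‖ ≤ ε) →
      Tendsto (fun n => ⨆ x ∈ Icc (0 : ℝ) 1, ‖u n x‖ₑ) atTop (𝓝 0) := by
    intro u hu
    rw [ENNReal.tendsto_nhds_zero]
    intro ε hε
    obtain ⟨r, hr0, hr⟩ := ENNReal.lt_iff_exists_nnreal_btwn.1 hε
    filter_upwards [hu r (by exact_mod_cast hr0)] with n hn
    refine iSup₂_le fun x hx => le_trans ?_ hr.le
    rw [← ofReal_norm, ← ENNReal.ofReal_coe_nnreal]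
    exact ENNReal.ofReal_le_ofReal (hn x hx)
  have hthird : Tendsto (fun n => ⨆ x ∈ Icc (0 : ℝ) 1, ⨆ y ∈ Icc (0 : ℝ) 1, ⨆ _ : x ≠ y,
      ‖((c n).vel x - c'.vel x) - ((c n).vel y - c'.vel y)‖ₑ / ENNReal.ofReal (|x - y| ^ α))
      atTop (𝓝 0) := by
    rw [ENNReal.tendsto_nhds_zero]
    intro ε hε
    obtain ⟨r, hr0, hr⟩ := ENNReal.lt_iff_exists_nnreal_btwn.1 hε
    obtain ⟨δ, hδ, hδr⟩ : ∃ δ : ℝ, 0 < δ ∧ C ^ (2 * α) * (2 * δ) ^ (1 - 2 * α) ≤ r := by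
      have : Tendsto (fun δ : ℝ => C ^ (2 * α) * (2 * δ) ^ (1 - 2 * α)) (𝓝[>] 0) (𝓝 0) := by
        have h : ContinuousAt (fun δ : ℝ => C ^ (2 * α) * (2 * δ) ^ (1 - 2 * α)) 0 :=
          continuousAt_const.mul ((continuousAt_const.mul continuousAt_id).rpow_const
            (Or.inr (by linarith)))
        have h' := h.tendsto.mono_left (nhdsWithin_le_nhds (s := Ioi 0))
        simpa [Real.zero_rpow (show (1 - 2 * α) ≠ 0 by linarith)] using h'
      obtain ⟨δ, h1, h2⟩ := ((this.eventually_le_const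
        (show (0 : ℝ) < r by exact_mod_cast hr0)).and self_mem_nhdsWithin).exists
      exact ⟨δ, h2, h1⟩
    filter_upwards [hv δ hδ] with n hn
    refine iSup₂_le fun x hx => iSup₂_le fun y hy => iSup_le fun hxy => le_trans ?_ hr.le
    have hd : 0 < |x - y| := abs_pos.2 (sub_ne_zero.2 hxy)
    refine ENNReal.div_le_of_le_mul ?_
    rw [← ofReal_norm, ← ENNReal.ofReal_coe_nnreal,
      ← ENNReal.ofReal_mul r.coe_nonneg]
    refine ENNReal.ofReal_le_ofReal ?_
    set N := ‖((c n).vel x - c'.vel x) - ((c n).vel y - c'.vel y)‖ with hN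
    have hN0 : 0 ≤ N := norm_nonneg _
    have hN1 : N ≤ C * √|x - y| := hH n x hx y hy
    have hN2 : N ≤ 2 * δ := by
      refine (norm_sub_le _ _).trans ?_
      linarith [hn x hx, hn y hy]
    -- Interpolation: the first factor is bounded by the `1/2`-Hölder estimate, producing `|x - y| ^
    -- α`, the second by uniform smallness. The exponent `1 - 2 * α` is positive because `α < 1/2`,
    -- so `δ` can make the product small.
    calc N = N ^ (2 * α) * N ^ (1 - 2 * α) := by
          rw [← Real.rpow_add_of_nonneg hN0 (by linarith) (by linarith)]
          simp
      _ ≤ (C * √|x - y|) ^ (2 * α) * (2 * δ) ^ (1 - 2 * α) := by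
          gcongr
          linarith
      _ = C ^ (2 * α) * (2 * δ) ^ (1 - 2 * α) * |x - y| ^ α := by
          rw [Real.mul_rpow hC (Real.sqrt_nonneg _), Real.sqrt_eq_rpow, ← Real.rpow_mul hd.le]
          ring_nf
      _ ≤ r * |x - y| ^ α := by gcongr
  have := ((hsup _ hp).add (hsup _ hv)).add hthird
  simpa [holderDist] using this

/-- Compactness of bounded sequences of controlled curves. -/
theorem exists_subseq_convergesTo {M : ℝ} (c : ℕ → H2Curve) (hc : ∀ n, Controlled M (c n))
    (h0 : ∀ n, ‖(c n).pos 0‖ ≤ M) :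
    ∃ φ : ℕ → ℕ, StrictMono φ ∧ ∃ c' : H2Curve, ConvergesTo (fun n => c (φ n)) c' := by
  have m0 : (0 : ℝ) ∈ Icc (0 : ℝ) 1 := by simp
  have hM : 0 ≤ M := (hc 0).nonneg
  obtain ⟨φ₁, hφ₁, b, hb, hw⟩ := exists_subseq_tendsto_integral_inner (sq_nonneg M)
    (fun n => (c n).acc) (fun n => (c n).memLp_acc) fun n => (hc n).integral_acc_sq_le'
  obtain ⟨⟨p0, v0⟩, -, φ₂, hφ₂, hpv⟩ := tendsto_subseq_of_bounded
    (s := Metric.closedBall (0 : Plane × Plane) M) Metric.isBounded_closedBall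
    (x := fun n => ((c (φ₁ n)).pos 0, (c (φ₁ n)).vel 0)) (fun n => by
      rw [mem_closedBall_zero_iff, Prod.norm_def]
      refine max_le (h0 _) ?_
      rw [(hc _).norm_vel 0 m0]
      exact (hc _).length_le)
  set φ := φ₁ ∘ φ₂ with hφ
  have hp0 : Tendsto (fun n => (c (φ n)).pos 0) atTop (𝓝 p0) :=
    (continuous_fst.tendsto _).comp hpv
  have hv0 : Tendsto (fun n => (c (φ n)).vel 0) atTop (𝓝 v0) :=
    (continuous_snd.tendsto _).comp hpv
  have hw' : ∀ d : ℝ → Plane, MemLp d 2 (volume.restrict (Ioo 0 1)) →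
      Tendsto (fun n => ∫ x in (0 : ℝ)..1, inner ℝ ((c (φ n)).acc x) (d x)) atTop
        (𝓝 (∫ x in (0 : ℝ)..1, inner ℝ (b x) (d x))) :=
    fun d hd => (hw d hd).comp hφ₂.tendsto_atTop
  -- The limit is built by integrating the weak limit `b` twice from the limits of the initial data,
  -- so continuity of `vel` and `pos` is automatic.
  set vel : ℝ → Plane := fun x => v0 + ∫ t in (0 : ℝ)..x, b t with hvel
  set pos : ℝ → Plane := fun x => p0 + ∫ t in (0 : ℝ)..x, vel t with hpos
  have hbi : IntervalIntegrable b volume 0 1 := by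
    rw [intervalIntegrable_iff_integrableOn_Ioo_of_le zero_le_one]
    exact hb.integrable (by norm_num)
  have hprim : ∀ u : ℝ → Plane, IntervalIntegrable u volume 0 1 →
      ContinuousOn (fun x => ∫ t in (0 : ℝ)..x, u t) (Icc 0 1) := by
    intro u hu
    have := intervalIntegral.continuousOn_primitive_interval' hu left_mem_uIcc
    rwa [uIcc_of_le zero_le_one] at this
  have hvelc : ContinuousOn vel (Icc 0 1) := continuousOn_const.add (hprim b hbi)
  have hveli : IntervalIntegrable vel volume 0 1 :=
    ContinuousOn.intervalIntegrable (by rwa [uIcc_of_le zero_le_one])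
  have hposc : ContinuousOn pos (Icc 0 1) := continuousOn_const.add (hprim vel hveli)
  have hposi : IntervalIntegrable pos volume 0 1 :=
    ContinuousOn.intervalIntegrable (by rwa [uIcc_of_le zero_le_one])
  have hvt : ∀ x ∈ Icc (0 : ℝ) 1, Tendsto (fun n => (c (φ n)).vel x) atTop (𝓝 (vel x)) := by
    intro x hx
    refine (hv0.add (tendsto_primitive_of_weak (fun n => (c (φ n)).memLp_acc) hb hw' hx)).congr
      fun n => ?_
    rw [← vel_sub_vel m0 hx]; abel
  have hvH : ∀ x ∈ Icc (0 : ℝ) 1, ∀ y ∈ Icc (0 : ℝ) 1, ‖vel x - vel y‖ ≤ M ^ 2 * √|x - y| :=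
    fun x hx y hy => le_of_tendsto ((hvt x hx).sub (hvt y hy)).norm
      (Eventually.of_forall fun n => (hc _).norm_vel_sub_le_of hx hy)
  have hdH : ∀ n, ∀ x ∈ Icc (0 : ℝ) 1, ∀ y ∈ Icc (0 : ℝ) 1,
      ‖((c (φ n)).vel x - vel x) - ((c (φ n)).vel y - vel y)‖ ≤ 2 * M ^ 2 * √|x - y| := by
    intro n x hx y hy
    rw [sub_sub_sub_comm]
    refine (norm_sub_le _ _).trans ?_
    linarith [(hc (φ n)).norm_vel_sub_le_of hx hy, hvH x hx y hy]
  have hvu : ∀ ε > 0, ∀ᶠ n in atTop, ∀ x ∈ Icc (0 : ℝ) 1, ‖(c (φ n)).vel x - vel x‖ ≤ ε :=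
    fun ε hε => eventually_norm_le_of_holder hdH
      (fun x hx => by simpa using (hvt x hx).sub_const (vel x)) hε
  have hpu : ∀ ε > 0, ∀ᶠ n in atTop, ∀ x ∈ Icc (0 : ℝ) 1, ‖(c (φ n)).pos x - pos x‖ ≤ ε := by
    intro ε hε
    have h1 : ∀ᶠ n in atTop, ‖(c (φ n)).pos 0 - p0‖ ≤ ε / 2 := by
      have : Tendsto (fun n => ‖(c (φ n)).pos 0 - p0‖) atTop (𝓝 0) := by
        simpa using (hp0.sub_const p0).norm
      exact this.eventually_le_const (half_pos hε)
    filter_upwards [h1, hvu (ε / 2) (half_pos hε)] with n hn1 hn2 x hx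
    have hsub : uIcc 0 x ⊆ uIcc 0 1 := by
      rw [uIcc_of_le hx.1, uIcc_of_le zero_le_one]; exact Icc_subset_Icc_right hx.2
    have e : (c (φ n)).pos x - pos x = ((c (φ n)).pos 0 - p0)
        + ∫ t in (0 : ℝ)..x, ((c (φ n)).vel t - vel t) := by
      rw [intervalIntegral.integral_sub ((c (φ n)).intervalIntegrable_vel.mono_set hsub)
        (hveli.mono_set hsub), ← pos_sub_pos m0 hx, hpos]
      simp only
      abel
    have h2 : ‖∫ t in (0 : ℝ)..x, ((c (φ n)).vel t - vel t)‖ ≤ ε / 2 * |x - 0| := by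
      refine intervalIntegral.norm_integral_le_of_norm_le_const fun t ht => hn2 t ?_
      rw [uIoc_of_le hx.1] at ht
      exact ⟨ht.1.le, ht.2.trans hx.2⟩
    have h3 : |x - 0| ≤ 1 := by rw [sub_zero, abs_of_nonneg hx.1]; exact hx.2
    rw [e]
    refine (norm_add_le _ _).trans ?_
    nlinarith
  have hpt : ∀ x ∈ Icc (0 : ℝ) 1, Tendsto (fun n => (c (φ n)).pos x) atTop (𝓝 (pos x)) := by
    intro x hx
    rw [tendsto_iff_norm_sub_tendsto_zero, Metric.tendsto_nhds]
    intro ε hε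
    filter_upwards [hpu (ε / 2) (half_pos hε)] with n hn
    rw [Real.dist_eq, sub_zero, abs_norm]
    linarith [hn x hx]
  have hposb : ∀ n, ∀ x ∈ Icc (0 : ℝ) 1, ‖(c (φ n)).pos x‖ ≤ 2 * M := by
    intro n x hx
    have := norm_add_le ((c (φ n)).pos x - (c (φ n)).pos 0) ((c (φ n)).pos 0)
    rw [sub_add_cancel] at this
    linarith [(hc (φ n)).norm_pos_sub_le m0 hx, h0 (φ n)]
  have hvelb : ∀ n, ∀ x ∈ Icc (0 : ℝ) 1, ‖(c (φ n)).vel x‖ ≤ M := by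
    intro n x hx
    rw [(hc _).norm_vel x hx]; exact (hc _).length_le
  have hposI : ∀ v : ℝ → Plane, ContinuousOn v (Icc 0 1) →
      Tendsto (fun n => ∫ x in (0 : ℝ)..1, inner ℝ ((c (φ n)).pos x) (v x)) atTop
        (𝓝 (∫ x in (0 : ℝ)..1, inner ℝ (pos x) (v x))) := fun v hv =>
    tendsto_integral_inner_of_pointwise (fun n => (c (φ n)).continuousOn_pos) hposb hpt hv
  have hvelI : ∀ v : ℝ → Plane, ContinuousOn v (Icc 0 1) →
      Tendsto (fun n => ∫ x in (0 : ℝ)..1, inner ℝ ((c (φ n)).vel x) (v x)) atTop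
        (𝓝 (∫ x in (0 : ℝ)..1, inner ℝ (vel x) (v x))) := fun v hv =>
    tendsto_integral_inner_of_pointwise (fun n => (c (φ n)).continuousOn_vel) hvelb hvt hv
  have hw1 : HasWeakDeriv pos vel :=
    hasWeakDeriv_of_tendsto (fun n => (c (φ n)).weak_vel)
      (fun n => ContinuousOn.intervalIntegrable (by
        rw [uIcc_of_le zero_le_one]; exact (c (φ n)).continuousOn_pos))
      (fun n => (c (φ n)).intervalIntegrable_vel) hposi hveli
      (fun v hv => hposI v hv.continuousOn) (fun v hv => hvelI v hv.continuousOn)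
  have hw2 : HasWeakDeriv vel b :=
    hasWeakDeriv_of_tendsto (fun n => (c (φ n)).weak_acc)
      (fun n => (c (φ n)).intervalIntegrable_vel)
      (fun n => (c (φ n)).intervalIntegrable_acc) hveli hbi
      (fun v hv => hvelI v hv.continuousOn)
      (fun v hv => hw' v (memLp_two_of_continuousOn hv.continuousOn))
  obtain ⟨c', e1, e2, e3⟩ : ∃ c' : H2Curve, c'.pos = pos ∧ c'.vel = vel ∧ c'.acc = b :=
    ⟨⟨pos, vel, b, hposc, hvelc, hb, hw1, hw2⟩, rfl, rfl, rfl⟩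
  clear_value pos vel
  subst e1 e2 e3
  exact ⟨φ, hφ₁.comp hφ₂, c', fun d => ((hposI d.pos d.continuousOn_pos).add
    (hvelI d.vel d.continuousOn_vel)).add (hw' d.acc d.memLp_acc),
    fun α => tendsto_holderDist (by positivity) hdH hpu hvu, hpt, hvt⟩

end H2Curve

/-! ### Unit vectors in the plane and limits of four-point sets -/

theorem angle_eq_two_pi_div_three_iff {u v : Plane} (hu : ‖u‖ = 1) (hv : ‖v‖ = 1) :
    InnerProductGeometry.angle u v = 2 * Real.pi / 3 ↔ inner ℝ u v = -(1 / 2 : ℝ) := by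
  have hcos : Real.cos (2 * Real.pi / 3) = -(1 / 2) := by
    rw [show 2 * Real.pi / 3 = Real.pi - Real.pi / 3 by ring, Real.cos_pi_sub,
      Real.cos_pi_div_three]
  have hangle : Real.cos (InnerProductGeometry.angle u v) = inner ℝ u v := by
    rw [InnerProductGeometry.cos_angle, hu, hv]; simp
  constructor
  · intro h
    rw [← hangle, h, hcos]
  · intro h
    refine Real.injOn_cos ⟨InnerProductGeometry.angle_nonneg _ _,
      InnerProductGeometry.angle_le_pi _ _⟩ ⟨by positivity, by linarith [Real.pi_pos]⟩ ?_
    rw [hangle, h, hcos]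

/-- Three unit vectors at angles of 120 degrees sum up to zero. -/
theorem add_eq_zero_of_inner {a b c : Plane} (ha : ‖a‖ = 1) (hb : ‖b‖ = 1) (hc : ‖c‖ = 1)
    (hab : inner ℝ a b = -(1 / 2 : ℝ)) (hac : inner ℝ a c = -(1 / 2 : ℝ))
    (hbc : inner ℝ b c = -(1 / 2 : ℝ)) : a + b + c = 0 := by
  rw [← norm_eq_zero, ← sq_eq_zero_iff, norm_add_sq_real, norm_add_sq_real, inner_add_left, ha, hb,
    hc, hab, hac, hbc]
  norm_num

/-- In the plane, two unit vectors at an angle of 120 degrees are determined up to order by their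
sum. -/
theorem eq_or_eq_swap_of_add_eq {a b a' b' : Plane} (ha : ‖a‖ = 1) (hb : ‖b‖ = 1)
    (ha' : ‖a'‖ = 1) (hb' : ‖b'‖ = 1) (hab : inner ℝ a b = -(1 / 2 : ℝ))
    (hab' : inner ℝ a' b' = -(1 / 2 : ℝ)) (hs : a + b = a' + b') :
    (a' = a ∧ b' = b) ∨ (a' = b ∧ b' = a) := by
  have hb'e : b' = a + b - a' := by rw [hs]; abel
  subst hb'e
  have hinner : ∀ u v : Plane, inner ℝ u v = u 0 * v 0 + u 1 * v 1 := fun u v => by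
    rw [EuclideanSpace.inner_eq_star_dotProduct]
    simp [dotProduct, Fin.sum_univ_two, mul_comm]
  have hn : ∀ u : Plane, ‖u‖ = 1 → u 0 * u 0 + u 1 * u 1 = 1 := fun u hu => by
    rw [← hinner, real_inner_self_eq_norm_sq, hu, one_pow]
  have e1 := hn a ha
  have e2 := hn b hb
  have e3 := hn a' ha'
  rw [hinner] at hab hab'
  simp only [PiLp.add_apply, PiLp.sub_apply] at hab'
  have hext : ∀ u v : Plane, u 0 = v 0 → u 1 = v 1 → u = v := fun u v h0 h1 => by
    ext i; fin_cases i; exacts [h0, h1]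
  have hprod : inner ℝ (a' - a) (a' - b) = (0 : ℝ) := by
    rw [hinner]
    simp only [PiLp.sub_apply]
    linear_combination hab - hab'
  -- Both `a' - a` and `a' - b` are orthogonal to the unit vector `a + b`, hence parallel to each
  -- other. They are also orthogonal by `hprod`, so one of them is zero; the Lagrange identity below
  -- expresses this.
  have hcross : (a' 0 - a 0) * (a' 1 - b 1) - (a' 1 - a 1) * (a' 0 - b 0) = 0 := by
    have hs1 : (a 0 + b 0) ^ 2 + (a 1 + b 1) ^ 2 = 1 := by linear_combination e1 + e2 + 2 * hab
    have hx : (a 0 + b 0) * (a' 0 - a 0) + (a 1 + b 1) * (a' 1 - a 1) = 0 := by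
      linear_combination hab' + e3 - e1 - hab
    have hy : (a 0 + b 0) * (a' 0 - b 0) + (a 1 + b 1) * (a' 1 - b 1) = 0 := by
      linear_combination hab' + e3 - e2 - hab
    linear_combination -((a' 0 - a 0) * (a' 1 - b 1) - (a' 1 - a 1) * (a' 0 - b 0)) * hs1
      + ((a 0 + b 0) * (a' 1 - b 1) - (a 1 + b 1) * (a' 0 - b 0)) * hx
      - ((a 0 + b 0) * (a' 1 - a 1) - (a 1 + b 1) * (a' 0 - a 0)) * hy
  have : ‖a' - a‖ ^ 2 * ‖a' - b‖ ^ 2 = 0 := by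
    rw [hinner] at hprod
    simp only [PiLp.sub_apply] at hprod
    rw [← real_inner_self_eq_norm_sq, ← real_inner_self_eq_norm_sq, hinner, hinner]
    simp only [PiLp.sub_apply]
    linear_combination ((a' 0 - a 0) * (a' 0 - b 0) + (a' 1 - a 1) * (a' 1 - b 1)) * hprod
      + ((a' 0 - a 0) * (a' 1 - b 1) - (a' 1 - a 1) * (a' 0 - b 0)) * hcross
  rcases mul_eq_zero.1 this with h | h
  · have : a' = a := by simpa [sub_eq_zero] using h
    left; subst this; simp
  · have : a' = b := by simpa [sub_eq_zero] using h
    right; subst this; simp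

/-- Membership in a set of four points passes to the limit. -/
theorem mem_four_of_tendsto {u p q r s : ℕ → Plane} {u' p' q' r' s' : Plane}
    (hu : Tendsto u atTop (𝓝 u')) (hp : Tendsto p atTop (𝓝 p')) (hq : Tendsto q atTop (𝓝 q'))
    (hr : Tendsto r atTop (𝓝 r')) (hs : Tendsto s atTop (𝓝 s'))
    (h : ∀ n, u n ∈ ({p n, q n, r n, s n} : Set Plane)) :
    u' ∈ ({p', q', r', s'} : Set Plane) := by
  -- Membership is the vanishing of the product of the four distances, a closed condition.
  have h1 := (((hu.sub hp).norm.mul (hu.sub hq).norm).mul (hu.sub hr).norm).mul (hu.sub hs).norm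
  have h2 : ‖u' - p'‖ * ‖u' - q'‖ * ‖u' - r'‖ * ‖u' - s'‖ = 0 := by
    refine tendsto_nhds_unique h1 (tendsto_const_nhds.congr fun n => ?_)
    have := h n
    simp only [mem_insert_iff, mem_singleton_iff] at this
    rcases this with h | h | h | h <;> simp [h]
  simp only [mul_eq_zero, norm_eq_zero, sub_eq_zero] at h2
  simp only [mem_insert_iff, mem_singleton_iff]
  tauto

/-- The equality of two sets of four points passes to the limit. -/
theorem four_eq_four_of_tendsto {a b c d p q r s : ℕ → Plane} {a' b' c' d' p' q' r' s' : Plane}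
    (ha : Tendsto a atTop (𝓝 a')) (hb : Tendsto b atTop (𝓝 b')) (hc : Tendsto c atTop (𝓝 c'))
    (hd : Tendsto d atTop (𝓝 d')) (hp : Tendsto p atTop (𝓝 p')) (hq : Tendsto q atTop (𝓝 q'))
    (hr : Tendsto r atTop (𝓝 r')) (hs : Tendsto s atTop (𝓝 s'))
    (h : ∀ n, ({a n, b n, c n, d n} : Set Plane) = {p n, q n, r n, s n}) :
    ({a', b', c', d'} : Set Plane) = {p', q', r', s'} := by
  apply Subset.antisymm
  · simp only [insert_subset_iff, singleton_subset_iff]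
    exact ⟨mem_four_of_tendsto ha hp hq hr hs fun n => h n ▸ (by simp),
      mem_four_of_tendsto hb hp hq hr hs fun n => h n ▸ (by simp),
      mem_four_of_tendsto hc hp hq hr hs fun n => h n ▸ (by simp),
      mem_four_of_tendsto hd hp hq hr hs fun n => h n ▸ (by simp)⟩
  · simp only [insert_subset_iff, singleton_subset_iff]
    exact ⟨mem_four_of_tendsto hp ha hb hc hd fun n => h n ▸ (by simp),
      mem_four_of_tendsto hq ha hb hc hd fun n => h n ▸ (by simp),
      mem_four_of_tendsto hr ha hb hc hd fun n => h n ▸ (by simp),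
      mem_four_of_tendsto hs ha hb hc hd fun n => h n ▸ (by simp)⟩

/-! ### Tangents and lengths of controlled curves, and their limits -/

namespace H2Curve

theorem IsRegular.norm_tangent {c : H2Curve} (h : c.IsRegular) {x : ℝ} (hx : x ∈ Icc (0 : ℝ) 1) :
    ‖c.tangent x‖ = 1 := by
  rw [tangent, norm_smul, norm_inv, norm_norm, inv_mul_cancel₀ (norm_ne_zero_iff.2 (h x hx))]

theorem isRegular_of_length_ne_zero {c : H2Curve}
    (hs : ∀ x ∈ Icc (0 : ℝ) 1, ‖c.vel x‖ = c.length) (h : c.length ≠ 0) : c.IsRegular :=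
  fun x hx => by rw [← norm_ne_zero_iff, hs x hx]; exact h

theorem IsRegular.length_pos {c : H2Curve} (h : c.IsRegular)
    (hs : ∀ x ∈ Icc (0 : ℝ) 1, ‖c.vel x‖ = c.length) : 0 < c.length := by
  rw [← hs 0 (by simp)]
  exact norm_pos_iff.2 (h 0 (by simp))

theorem Controlled.norm_tangent_sub_le {M : ℝ} {c : H2Curve} (h : Controlled M c)
    (hr : c.IsRegular) : ‖c.tangent 0 - c.tangent 1‖ ≤ √(M * c.length) := by
  have hL := hr.length_pos h.norm_vel
  have h1 := h.norm_vel_sub_le_length_mul (x := 0) (y := 1) (by simp) (by simp)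
  rw [tangent, tangent, h.norm_vel 0 (by simp), h.norm_vel 1 (by simp), ← smul_sub, norm_smul,
    norm_inv, Real.norm_of_nonneg hL.le, inv_mul_le_iff₀ hL]
  exact h1

theorem Controlled.norm_chord_sub_tangent_le {M : ℝ} {c : H2Curve} (h : Controlled M c)
    (hr : c.IsRegular) :
    ‖c.length⁻¹ • (c.pos 1 - c.pos 0) - c.tangent 0‖ ≤ √(M * c.length) := by
  have hL := hr.length_pos h.norm_vel
  rw [tangent, h.norm_vel 0 (by simp), ← smul_sub, norm_smul,
    norm_inv, Real.norm_of_nonneg hL.le, inv_mul_le_iff₀ hL]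
  exact h.norm_chord_sub_vel_le

/-- The length of a closed curve is bounded below. -/
theorem Controlled.one_le_mul_length {M : ℝ} {c : H2Curve} (h : Controlled M c)
    (hr : c.IsRegular) (hcl : c.pos 1 = c.pos 0) : 1 ≤ M * c.length := by
  have h1 := h.norm_chord_sub_tangent_le hr
  rw [hcl, sub_self, smul_zero, zero_sub, norm_neg, hr.norm_tangent (by simp)] at h1
  exact Real.one_le_sqrt.1 h1

theorem pos_eq_of_length_eq_zero {c : H2Curve} (h : c.length = 0) : c.pos 1 = c.pos 0 := by
  have h1 := (controlled_of_length_eq_zero le_rfl h).norm_pos_sub_le (x := 0) (y := 1)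
    (by simp) (by simp)
  exact sub_eq_zero.1 (norm_le_zero_iff.1 h1)

namespace ConvergesTo

variable {c : ℕ → H2Curve} {c' : H2Curve} {M : ℝ}

/-- Constancy of the speed survives pointwise convergence of velocities. Hence a limit curve is
either regular or of length zero, with nothing in between. -/
theorem norm_vel (h : ConvergesTo c c') (hc : ∀ n, Controlled M (c n)) :
    ∀ x ∈ Icc (0 : ℝ) 1, ‖c'.vel x‖ = c'.length := by
  have m0 : (0 : ℝ) ∈ Icc (0 : ℝ) 1 := by simp
  have h1 : ∀ x ∈ Icc (0 : ℝ) 1, ‖c'.vel x‖ = ‖c'.vel 0‖ := fun x hx =>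
    tendsto_nhds_unique (h.vel x hx).norm ((h.vel 0 m0).norm.congr fun n => by
      rw [(hc n).norm_vel x hx, (hc n).norm_vel 0 m0])
  intro x hx
  rw [h1 x hx, length, intervalIntegral.integral_congr (g := fun _ => ‖c'.vel 0‖)]
  · simp
  · intro y hy
    rw [uIcc_of_le zero_le_one] at hy
    exact h1 y hy

theorem length (h : ConvergesTo c c') (hc : ∀ n, Controlled M (c n)) :
    Tendsto (fun n => (c n).length) atTop (𝓝 c'.length) := by
  have m0 : (0 : ℝ) ∈ Icc (0 : ℝ) 1 := by simp
  rw [← h.norm_vel hc 0 m0]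
  exact (h.vel 0 m0).norm.congr fun n => (hc n).norm_vel 0 m0

theorem tangent (h : ConvergesTo c c') (hr : c'.IsRegular) {x : ℝ} (hx : x ∈ Icc (0 : ℝ) 1) :
    Tendsto (fun n => (c n).tangent x) atTop (𝓝 (c'.tangent x)) :=
  ((h.vel x hx).norm.inv₀ (norm_ne_zero_iff.2 (hr x hx))).smul (h.vel x hx)

theorem tendsto_sqrt (h : ConvergesTo c c') (hc : ∀ n, Controlled M (c n)) (h0 : c'.length = 0) :
    Tendsto (fun n => √(M * (c n).length)) atTop (𝓝 0) := by
  have := (((h.length hc).const_mul M)).sqrt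
  rwa [h0, mul_zero, Real.sqrt_zero] at this

end ConvergesTo

end H2Curve

/-! ### Networks: compactness and identification of the limit -/

namespace ThreeNetwork

open H2Curve

/-- Bounded energy controls the curves, and only (possibly degenerate) Theta-networks have finite
energy. -/
theorem controlled_of_extendedEnergy_le {Γ : ThreeNetwork} {M : ℝ}
    (h : Γ.extendedEnergy ≤ (M : EReal)) :
    (∀ i, Controlled M (Γ.curve i)) ∧ (Γ.IsTheta ∨ Γ.IsDegenerateTheta) := by
  unfold extendedEnergy at h
  split_ifs at h with h1 h2
  · rw [EReal.coe_le_coe_iff] at h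
    refine ⟨fun i => controlled_of_energy_le (h1.1 i) (Γ.constSpeed i (h1.1 i)) (le_trans ?_ h),
      Or.inl h1⟩
    exact Finset.single_le_sum (f := fun i => (Γ.curve i).energy)
      (fun i _ => energy_nonneg) (Finset.mem_univ i)
  · rw [EReal.coe_le_coe_iff] at h
    refine ⟨fun i => ?_, Or.inr h2⟩
    have hM : 0 ≤ M := le_trans (Finset.sum_nonneg fun i _ => energy_nonneg) h
    by_cases hi : (Γ.curve i).length = 0
    · exact controlled_of_length_eq_zero hM hi
    · have hr : (Γ.curve i).IsRegular := by
        obtain ⟨i', j', k', hij, hik, hjk, hri, hrj, hk, -⟩ := h2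
        have hik' : i ≠ k' := fun h => hi (h ▸ hk)
        have : i = i' ∨ i = j' := by omega
        rcases this with rfl | rfl
        exacts [hri, hrj]
      refine controlled_of_energy_le hr (Γ.constSpeed i hr) (le_trans ?_ h)
      exact Finset.single_le_sum (f := fun i => (Γ.curve i).energy)
        (fun i _ => energy_nonneg) (by simp [hi])
  · exact absurd h (by simp)

/-- In a (possibly degenerate) Theta-network at most one curve has length zero. -/
theorem eq_of_length_eq_zero {Γ : ThreeNetwork} (h : Γ.IsTheta ∨ Γ.IsDegenerateTheta) {i j : Fin 3}
    (hi : (Γ.curve i).length = 0) (hj : (Γ.curve j).length = 0) : i = j := by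
  have hreg : ∀ i, (Γ.curve i).IsRegular → (Γ.curve i).length ≠ 0 := fun i hr =>
    (hr.length_pos (Γ.constSpeed i hr)).ne'
  rcases h with h | ⟨i', j', k', hij, hik, hjk, hri, hrj, -⟩
  · exact absurd hi (hreg i (h.1 i))
  · have hz : ∀ l, (Γ.curve l).length = 0 → l = k' := by
      intro l hl
      have h1 : l ≠ i' := fun h => hreg _ hri (h ▸ hl)
      have h2 : l ≠ j' := fun h => hreg _ hrj (h ▸ hl)
      omega
    rw [hz i hi, hz j hj]

/-- Compactness for networks: all three curves converge along a subsequence. -/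
theorem exists_subseq_convergesTo {Γ : ℕ → ThreeNetwork} {M : ℝ}
    (hΓ : ∀ n i, Controlled M ((Γ n).curve i)) (horigin : ∀ n, (Γ n).P₁ = 0 ∨ (Γ n).P₂ = 0) :
    ∃ φ : ℕ → ℕ, StrictMono φ ∧ ∃ Γ' : ThreeNetwork,
      ∀ i, ConvergesTo (fun n => (Γ (φ n)).curve i) (Γ'.curve i) := by
  have m0 : (0 : ℝ) ∈ Icc (0 : ℝ) 1 := by simp
  have m1 : (1 : ℝ) ∈ Icc (0 : ℝ) 1 := by simp
  have h0 : ∀ n i, ‖((Γ n).curve i).pos 0‖ ≤ M := by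
    intro n i
    rcases horigin n with h | h
    · rw [(Γ n).start_eq i, h, norm_zero]; exact (hΓ n i).nonneg
    · have := (hΓ n i).norm_pos_sub_le m1 m0
      rwa [(Γ n).end_eq i, h, sub_zero] at this
  obtain ⟨φ₀, hφ₀, c₀, hc₀⟩ := H2Curve.exists_subseq_convergesTo (fun n => (Γ n).curve 0)
    (fun n => hΓ n 0) fun n => h0 n 0
  obtain ⟨φ₁, hφ₁, c₁, hc₁⟩ := H2Curve.exists_subseq_convergesTo (fun n => (Γ (φ₀ n)).curve 1)
    (fun n => hΓ _ 1) fun n => h0 _ 1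
  obtain ⟨φ₂, hφ₂, c₂, hc₂⟩ := H2Curve.exists_subseq_convergesTo
    (fun n => (Γ (φ₀ (φ₁ n))).curve 2) (fun n => hΓ _ 2) fun n => h0 _ 2
  have hconv : ∀ i, ConvergesTo (fun n => (Γ (φ₀ (φ₁ (φ₂ n)))).curve i) (![c₀, c₁, c₂] i) := by
    intro i
    fin_cases i
    · exact hc₀.comp (hφ₁.comp hφ₂)
    · exact hc₁.comp hφ₂
    · exact hc₂
  refine ⟨_, hφ₀.comp (hφ₁.comp hφ₂), ⟨![c₀, c₁, c₂], c₀.pos 0, c₀.pos 1, fun i => ?_, fun i => ?_,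
    fun i _ => (hconv i).norm_vel fun n => hΓ _ i⟩, hconv⟩
  · refine tendsto_nhds_unique ((hconv i).pos 0 m0) (((hconv 0).pos 0 m0).congr fun n => ?_)
    rw [start_eq, start_eq]
  · refine tendsto_nhds_unique ((hconv i).pos 1 m1) (((hconv 0).pos 1 m1).congr fun n => ?_)
    rw [end_eq, end_eq]

theorem IsTheta.inner_tangent {Γ : ThreeNetwork} (h : Γ.IsTheta) {i j : Fin 3} (hij : i ≠ j) :
    inner ℝ ((Γ.curve i).tangent 0) ((Γ.curve j).tangent 0) = -(1 / 2 : ℝ) ∧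
      inner ℝ ((Γ.curve i).tangent 1) ((Γ.curve j).tangent 1) = -(1 / 2 : ℝ) := by
  have hn : ∀ i, ∀ x ∈ Icc (0 : ℝ) 1, ‖(Γ.curve i).tangent x‖ = 1 := fun i x hx =>
    (h.1 i).norm_tangent hx
  have := h.2 i j hij
  rwa [angle_eq_two_pi_div_three_iff (hn i 0 (by simp)) (hn j 0 (by simp)),
    angle_eq_two_pi_div_three_iff (hn i 1 (by simp)) (hn j 1 (by simp))] at this

/-- At both junctions of a Theta-network the unit tangents sum up to zero. -/
theorem IsTheta.tangent_add {Γ : ThreeNetwork} (h : Γ.IsTheta) {i j k : Fin 3} (hij : i ≠ j)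
    (hik : i ≠ k) (hjk : j ≠ k) :
    (Γ.curve i).tangent 0 + (Γ.curve j).tangent 0 = -(Γ.curve k).tangent 0 ∧
      (Γ.curve i).tangent 1 + (Γ.curve j).tangent 1 = -(Γ.curve k).tangent 1 := by
  have hn : ∀ i, ∀ x ∈ Icc (0 : ℝ) 1, ‖(Γ.curve i).tangent x‖ = 1 := fun i x hx =>
    (h.1 i).norm_tangent hx
  constructor
  · exact eq_neg_of_add_eq_zero_left (add_eq_zero_of_inner (hn i 0 (by simp)) (hn j 0 (by simp))
      (hn k 0 (by simp)) (h.inner_tangent hij).1 (h.inner_tangent hik).1 (h.inner_tangent hjk).1)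
  · exact eq_neg_of_add_eq_zero_left (add_eq_zero_of_inner (hn i 1 (by simp)) (hn j 1 (by simp))
      (hn k 1 (by simp)) (h.inner_tangent hij).2 (h.inner_tangent hik).2 (h.inner_tangent hjk).2)

variable {Γ : ℕ → ThreeNetwork} {Γ' : ThreeNetwork} {M : ℝ}

/-- In a Theta-network, two different curves cannot both be close to straight segments. -/
theorem IsTheta.lt_sqrt_or_lt_sqrt {Γ : ThreeNetwork} (h : Γ.IsTheta)
    (hc : ∀ i, Controlled M (Γ.curve i)) {i j : Fin 3} (hij : i ≠ j)
    (hi : √(M * (Γ.curve i).length) ≤ 1 / 10) : 1 / 10 < √(M * (Γ.curve j).length) := by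
  by_contra! hj
  have Li := (h.1 i).length_pos (hc i).norm_vel
  have Lj := (h.1 j).length_pos (hc j).norm_vel
  have hi' := ((hc i).norm_chord_sub_tangent_le (h.1 i)).trans hi
  have hj' := ((hc j).norm_chord_sub_tangent_le (h.1 j)).trans hj
  rw [Γ.start_eq, Γ.end_eq] at hi' hj'
  set u := (Γ.curve i).length⁻¹ • (Γ.P₂ - Γ.P₁) with hu
  set v := (Γ.curve j).length⁻¹ • (Γ.P₂ - Γ.P₁) with hv
  have huv : 0 ≤ inner ℝ u v := by
    rw [hu, hv, real_inner_smul_left, real_inner_smul_right, real_inner_self_eq_norm_sq]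
    positivity
  set a := (Γ.curve i).tangent 0 with ha
  set b := (Γ.curve j).tangent 0 with hb
  have hna : ‖a‖ = 1 := (h.1 i).norm_tangent (by simp)
  have hnb : ‖b‖ = 1 := (h.1 j).norm_tangent (by simp)
  have hab : inner ℝ a b = -(1 / 2 : ℝ) := (h.inner_tangent hij).1
  -- The rescaled chords `u`, `v` are nonnegative multiples of one vector, so the left side is
  -- nonnegative; the right side is at most `-1/2 + 1/10 + 1/10 + 1/100 < 0`. This is what fixes the
  -- threshold `1/10`.
  have e : inner ℝ u v = inner ℝ a b + inner ℝ (u - a) b + inner ℝ a (v - b)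
      + inner ℝ (u - a) (v - b) := by
    simp only [inner_sub_left, inner_sub_right]; ring
  have h1 := real_inner_le_norm (u - a) b
  have h2 := real_inner_le_norm a (v - b)
  have h3 := real_inner_le_norm (u - a) (v - b)
  have h4 : ‖u - a‖ * ‖v - b‖ ≤ 1 / 10 * (1 / 10) := by gcongr
  rw [hnb] at h1
  rw [hna] at h2
  linarith

/-- Limits of Theta-networks. -/
theorem isTheta_or_isDegenerateTheta_of_isTheta (hΓ : ∀ n i, Controlled M ((Γ n).curve i))
    (hconv : ∀ i, ConvergesTo (fun n => (Γ n).curve i) (Γ'.curve i))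
    (hθ : ∀ n, (Γ n).IsTheta) : Γ'.IsTheta ∨ Γ'.IsDegenerateTheta := by
  have m0 : (0 : ℝ) ∈ Icc (0 : ℝ) 1 := by simp
  have m1 : (1 : ℝ) ∈ Icc (0 : ℝ) 1 := by simp
  have hreg : ∀ i, (Γ'.curve i).length ≠ 0 → (Γ'.curve i).IsRegular := fun i =>
    isRegular_of_length_ne_zero ((hconv i).norm_vel fun n => hΓ n i)
  have hinner : ∀ i j, i ≠ j → (Γ'.curve i).IsRegular → (Γ'.curve j).IsRegular →
      inner ℝ ((Γ'.curve i).tangent 0) ((Γ'.curve j).tangent 0) = -(1 / 2 : ℝ) ∧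
        inner ℝ ((Γ'.curve i).tangent 1) ((Γ'.curve j).tangent 1) = -(1 / 2 : ℝ) := by
    intro i j hij hi hj
    exact ⟨tendsto_nhds_unique (((hconv i).tangent hi m0).inner ((hconv j).tangent hj m0))
        (tendsto_const_nhds.congr fun n => ((hθ n).inner_tangent hij).1.symm),
      tendsto_nhds_unique (((hconv i).tangent hi m1).inner ((hconv j).tangent hj m1))
        (tendsto_const_nhds.congr fun n => ((hθ n).inner_tangent hij).2.symm)⟩
  by_cases hall : ∀ i, (Γ'.curve i).length ≠ 0
  · left
    have hr : ∀ i, (Γ'.curve i).IsRegular := fun i => hreg i (hall i)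
    refine ⟨hr, fun i j hij => ?_⟩
    rw [angle_eq_two_pi_div_three_iff ((hr i).norm_tangent m0) ((hr j).norm_tangent m0),
      angle_eq_two_pi_div_three_iff ((hr i).norm_tangent m1) ((hr j).norm_tangent m1)]
    exact hinner i j hij (hr i) (hr j)
  · right
    push Not at hall
    obtain ⟨k, hk⟩ := hall
    have hsq : ∀ i, (Γ'.curve i).length = 0 →
        Tendsto (fun n => √(M * ((Γ n).curve i).length)) atTop (𝓝 0) := fun i =>
      (hconv i).tendsto_sqrt fun n => hΓ n i
    have hother : ∀ i, i ≠ k → (Γ'.curve i).IsRegular := by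
      intro i hik
      refine hreg i fun hi => ?_
      obtain ⟨n, hn1, hn2⟩ := (((hsq i hi).eventually_le_const (show (0 : ℝ) < 1 / 10 by
        norm_num)).and ((hsq k hk).eventually_le_const (show (0 : ℝ) < 1 / 10 by
        norm_num))).exists
      exact absurd ((hθ n).lt_sqrt_or_lt_sqrt (hΓ n) hik hn1) (not_lt.2 hn2)
    obtain ⟨i, j, hij, hik, hjk⟩ : ∃ i j : Fin 3, i ≠ j ∧ i ≠ k ∧ j ≠ k := by
      have : ∀ k : Fin 3, ∃ i j : Fin 3, i ≠ j ∧ i ≠ k ∧ j ≠ k := by decide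
      exact this k
    have ri := hother i hik
    have rj := hother j hjk
    have hk01 : Tendsto (fun n => ((Γ n).curve k).tangent 0 - ((Γ n).curve k).tangent 1) atTop
        (𝓝 0) :=
      squeeze_zero_norm (fun n => (hΓ n k).norm_tangent_sub_le ((hθ n).1 k)) (hsq k hk)
    have hsum : (Γ'.curve i).tangent 0 + (Γ'.curve j).tangent 0
        = (Γ'.curve i).tangent 1 + (Γ'.curve j).tangent 1 := by
      have hs := (((hconv i).tangent ri m0).add ((hconv j).tangent rj m0)).sub
        (((hconv i).tangent ri m1).add ((hconv j).tangent rj m1))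
      rw [← sub_eq_zero]
      refine tendsto_nhds_unique hs ((neg_zero (G := Plane) ▸ hk01.neg).congr fun n => ?_)
      rw [((hθ n).tangent_add hij hik hjk).1, ((hθ n).tangent_add hij hik hjk).2]
      abel
    have hin := hinner i j hij ri rj
    refine ⟨i, j, k, hij, hik, hjk, ri, rj, hk, (Γ'.curve i).tangent 0, (Γ'.curve j).tangent 0,
      ri.norm_tangent m0, rj.norm_tangent m0,
      (angle_eq_two_pi_div_three_iff (ri.norm_tangent m0) (rj.norm_tangent m0)).2 hin.1, ?_⟩
    -- Either each curve returns with its initial tangent, or the two curves exchange tangents; the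
    -- set of four outgoing directions is the same in both cases.
    rcases eq_or_eq_swap_of_add_eq (ri.norm_tangent m0) (rj.norm_tangent m0) (ri.norm_tangent m1)
      (rj.norm_tangent m1) hin.1 hin.2 hsum with ⟨e1, e2⟩ | ⟨e1, e2⟩
    · rw [e1, e2]
    · rw [e1, e2]
      ext x
      simp only [mem_insert_iff, mem_singleton_iff]
      tauto

/-- Limits of degenerate Theta-networks. -/
theorem isDegenerateTheta_of_isDegenerateTheta (hΓ : ∀ n i, Controlled M ((Γ n).curve i))
    (hconv : ∀ i, ConvergesTo (fun n => (Γ n).curve i) (Γ'.curve i))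
    (hθ : ∀ n, (Γ n).IsDegenerateTheta) : Γ'.IsDegenerateTheta := by
  have m0 : (0 : ℝ) ∈ Icc (0 : ℝ) 1 := by simp
  have m1 : (1 : ℝ) ∈ Icc (0 : ℝ) 1 := by simp
  choose i j k hij hik hjk hri hrj hk v w hv hw hvw hset using hθ
  -- The roles of the curves may vary with `n`; by pigeonhole one assignment recurs infinitely
  -- often. A further extraction makes the directions `v`, `w` converge.
  obtain ⟨⟨i', j', k'⟩, hfreq⟩ : ∃ p : Fin 3 × Fin 3 × Fin 3,
      ∃ᶠ n in atTop, (i n, j n, k n) = p := by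
    by_contra! hne
    obtain ⟨n, hn⟩ := (eventually_all.2 hne).exists
    exact hn _ rfl
  obtain ⟨φ, hφ, hφe⟩ := extraction_of_frequently_atTop hfreq
  obtain ⟨⟨v', w'⟩, -, ψ, hψ, hvw'⟩ := tendsto_subseq_of_bounded
    (s := Metric.closedBall (0 : Plane × Plane) 1) Metric.isBounded_closedBall
    (x := fun n => (v (φ n), w (φ n))) (fun n => by
      rw [mem_closedBall_zero_iff, Prod.norm_def, hv, hw, max_self])
  set θ := φ ∘ ψ with hθdef
  have hθm : StrictMono θ := hφ.comp hψ
  have hidx : ∀ n, i (θ n) = i' ∧ j (θ n) = j' ∧ k (θ n) = k' := fun n => by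
    simpa [hθdef] using hφe (ψ n)
  have hvt : Tendsto (fun n => v (θ n)) atTop (𝓝 v') := (continuous_fst.tendsto _).comp hvw'
  have hwt : Tendsto (fun n => w (θ n)) atTop (𝓝 w') := (continuous_snd.tendsto _).comp hvw'
  have hv' : ‖v'‖ = 1 := tendsto_nhds_unique hvt.norm
    (tendsto_const_nhds.congr fun n => (hv _).symm)
  have hw' : ‖w'‖ = 1 := tendsto_nhds_unique hwt.norm
    (tendsto_const_nhds.congr fun n => (hw _).symm)
  have hc : ∀ i, ConvergesTo (fun n => (Γ (θ n)).curve i) (Γ'.curve i) := fun i =>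
    (hconv i).comp hθm
  have hreg : ∀ l, (∀ n, ((Γ (θ n)).curve l).IsRegular) → (Γ'.curve l).IsRegular := by
    intro l hl
    refine isRegular_of_length_ne_zero ((hconv l).norm_vel fun n => hΓ n l) fun h0 => ?_
    have ht := (((hc l).length fun n => hΓ _ l).const_mul M)
    rw [h0, mul_zero] at ht
    -- The collapsed curve makes the junctions coincide, so curve `l` is closed and `1 ≤ M * L`
    -- along the sequence, contradicting `M * L → 0`.
    have := ge_of_tendsto' ht fun n => (hΓ (θ n) l).one_le_mul_length (hl n) (by
      have := pos_eq_of_length_eq_zero (hk (θ n))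
      rw [start_eq, end_eq] at this ⊢
      exact this)
    linarith
  have ri : (Γ'.curve i').IsRegular := hreg i' fun n => (hidx n).1 ▸ hri (θ n)
  have rj : (Γ'.curve j').IsRegular := hreg j' fun n => (hidx n).2.1 ▸ hrj (θ n)
  refine ⟨i', j', k', ?_, ?_, ?_, ri, rj, ?_, v', w', hv', hw', ?_, ?_⟩
  · have := hij (θ 0); rwa [(hidx 0).1, (hidx 0).2.1] at this
  · have := hik (θ 0); rwa [(hidx 0).1, (hidx 0).2.2] at this
  · have := hjk (θ 0); rwa [(hidx 0).2.1, (hidx 0).2.2] at this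
  · refine tendsto_nhds_unique ((hc k').length fun n => hΓ _ k')
      (tendsto_const_nhds.congr fun n => ?_)
    rw [← (hidx n).2.2]
    exact (hk (θ n)).symm
  · rw [angle_eq_two_pi_div_three_iff hv' hw']
    exact tendsto_nhds_unique (hvt.inner hwt) (tendsto_const_nhds.congr fun n =>
      ((angle_eq_two_pi_div_three_iff (hv _) (hw _)).1 (hvw _)).symm)
  · refine four_eq_four_of_tendsto ((hc i').tangent ri m0) ((hc i').tangent ri m1).neg
      ((hc j').tangent rj m0) ((hc j').tangent rj m1).neg hvt hvt.neg hwt hwt.neg fun n => ?_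
    have := hset (θ n)
    rwa [(hidx n).1, (hidx n).2.1] at this

end ThreeNetwork

/-! ### The compactness theorem -/

theorem mainTheorem5 (Γ : ℕ → ThreeNetwork)
    (horigin : ∀ n, (Γ n).P₁ = 0 ∨ (Γ n).P₂ = 0)
    (hbound : limsup (fun n => (Γ n).extendedEnergy) atTop < ⊤) :
    ∃ φ : ℕ → ℕ, StrictMono φ ∧ ∃ Γ' : ThreeNetwork,
      (∀ i, H2Curve.WeakTendsto (fun n => (Γ (φ n)).curve i) (Γ'.curve i)) ∧
      (∀ α : ℝ, 0 < α → α < 1 / 2 → ∀ i,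
        Tendsto (fun n => H2Curve.holderDist α ((Γ (φ n)).curve i) (Γ'.curve i))
          atTop (𝓝 0)) ∧
      (Γ'.IsTheta ∨ Γ'.IsDegenerateTheta) ∧
      (∀ i j, (Γ'.curve i).length = 0 → (Γ'.curve j).length = 0 → i = j) := by
  obtain ⟨M, hM, -⟩ := EReal.lt_iff_exists_real_btwn.1 hbound
  obtain ⟨φ₀, hφ₀, hle⟩ := extraction_of_eventually_atTop (eventually_lt_of_limsup_lt hM)
  have hctl := fun n => ThreeNetwork.controlled_of_extendedEnergy_le (hle n).le
  obtain ⟨φ₁, hφ₁, Γ', hconv⟩ := ThreeNetwork.exists_subseq_convergesTo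
    (fun n => (hctl n).1) fun n => horigin (φ₀ n)
  have hlim : Γ'.IsTheta ∨ Γ'.IsDegenerateTheta := by
    -- The limit is already fixed, so its type may be read off along any further subsequence. If
    -- Theta-networks do not recur, finite energy makes the tail degenerate.
    by_cases hf : ∃ᶠ n in atTop, (Γ (φ₀ (φ₁ n))).IsTheta
    · obtain ⟨ψ, hψ, hθ⟩ := extraction_of_frequently_atTop hf
      exact ThreeNetwork.isTheta_or_isDegenerateTheta_of_isTheta
        (fun n i => (hctl (φ₁ (ψ n))).1 i) (fun i => (hconv i).comp hψ) hθ
    · obtain ⟨ψ, hψ, hθ⟩ := extraction_of_eventually_atTop (not_frequently.1 hf)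
      exact Or.inr (ThreeNetwork.isDegenerateTheta_of_isDegenerateTheta
        (fun n i => (hctl (φ₁ (ψ n))).1 i) (fun i => (hconv i).comp hψ)
        fun n => (hctl (φ₁ (ψ n))).2.resolve_left (hθ n))
  exact ⟨φ₀ ∘ φ₁, hφ₀.comp hφ₁, Γ', fun i => (hconv i).weak,
    fun α h0 h1 i => (hconv i).holder α h0 h1, hlim,
    fun i j => ThreeNetwork.eq_of_length_eq_zero hlim⟩
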